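/- Conventions. An (a,b)-module is a free $\mathbb{C}[[b]]$-module $E$ of finite rank with a $\mathbb{C}$-linear map $a : E \to E$ such that $ab - ba = b^2$ (hence $aS = Sa + b^2 S'$ for $S \in \mathbb{C}[[b]]$). For $\delta \in \mathbb{Q}$, $E_\delta = \mathbb{C}[[b]]\,e_\delta$ with $a e_\delta = \delta b e_\delta$. The dual $E^*$ is $\mathrm{Hom}_{\mathbb{C}[[b]]}(E, E_0)$ with $(a f)(x) = a(f(x)) - f(a x)$, and $E \otimes_{a,b} F$ is $E \otimes_{\mathbb{C}[[b]]} F$ with $a(x \otimes y) = ax \otimes y + x \otimes ay$. For $\Lambda \subset\, ]0,1] \cap \mathbb{Q}$ finite, $\Xi_\Lambda^{(N)} = \bigoplus_{\lambda \in \Lambda} \bigoplus_{j=0}^N \mathbb{C}[[b]]\,e_{\lambda,j}$ with $a e_{\lambda,0} = \lambda b e_{\lambda,0}$ and $a e_{\lambda,j} = \lambda b e_{\lambda,j} + b e_{\lambda,j-1}$ for $j \ge 1$. A theme is an (a,b)-module isomorphic to the submodule of some $\Xi_\Lambda^{(N)}$ generated over $\mathbb{C}[[b]]$ by $a^\nu\varphi$,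 $\nu \ge 0$, for one element $\varphi$; it is $[\lambda]$-primitive, for $\lambda \in\, ]0,1] \cap \mathbb{Q}$, if one can take $\Lambda = \{\lambda\}$. Let $X$ be a reduced complex space. A sheaf of $\mathcal{O}_X$-(a,b)-modules is a locally free sheaf $\mathbb{E}$ of finite type of $\mathcal{O}_X[[b]]$-modules with an $\mathcal{O}_X$-linear, $b$-adically continuous map $a : \mathbb{E} \to \mathbb{E}$ such that $ab - ba = b^2$; its fibres are the (a,b)-modules $E(x) = \mathbb{E}/\mathcal{M}_x[[b]]\,\mathbb{E}$, where $\mathcal{M}_x[[b]]$ is the kernel of the evaluation $\mathcal{O}_X[[b]] \to \mathbb{C}[[b]]$ at $x$. A holomorphic map $\varphi : U \to \Xi_\Lambda^{(N)}$ on an open set $U$ (a section of $\bigoplus_{\lambda,j} \mathcal{O}_X[[b]]\,e_{\lambda,j}$ on $U$) is $k$-thematic if the $\mathcal{O}_U[[b]]$-module $\mathbb{E}_\varphi$ generated by the $a^\nu \varphi$, $\nu \ge 0$, is free with basis $\varphi, a\varphi, \dots, a^{k-1}\varphi$ and, for each $x \in U$, the elements $\varphi(x), a\varphi(x), \dots,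 a^{k-1}\varphi(x)$ are linearly independent over $\mathbb{C}[[b]]$ (so that the fibre of $\mathbb{E}_\varphi$ at $x$ is the submodule generated by the $a^\nu\varphi(x)$). The sheaf $\mathbb{E}$ is a holomorphic family of rank $k$ themes if $X$ is covered by open sets $U$ for each of which there are a finite set $\Lambda \subset\, ]0,1] \cap \mathbb{Q}$, a $k$-thematic map $\varphi : U \to \Xi_\Lambda^{(k-1)}$ and an isomorphism $\mathbb{E}|_U \simeq \mathbb{E}_\varphi$ of sheaves of $\mathcal{O}_U$-(a,b)-modules (with $\Xi_\Lambda^{(-1)} = 0$). Theorem. Let $X$ be a reduced complex space, let $\lambda \in\, ]0,1] \cap \mathbb{Q}$ and let $\mathbb{E}$ be a holomorphic family of rank $k$ themes on $X$ all of whose fibres $E(x)$, $x \in X$, are $[\lambda]$-primitive themes. Let $\delta \in \mathbb{Q}$ be such that for each $x \in X$ the (a,b)-module $E(x)^* \otimes_{a,b} E_\delta$ is a theme. Then the family $E(x)^* \otimes_{a,b} E_\delta$, $x \in X$, that is, the sheaf of $\mathcal{O}_X$-(a,b)-modules $\mathcal{H}om_{\mathcal{O}_X[[b]]}(\mathbb{E},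 \mathcal{O}_X[[b]]) \otimes_{a,b} E_\delta$, whose fibres are the $E(x)^* \otimes_{a,b} E_\delta$, is a holomorphic family of rank $k$ themes. -/

import Mathlib

open TopologicalSpace
open scoped PowerSeries TensorProduct

universe u v

noncomputable section

namespace Themes

/-! ### (a,b)-modules -/

/-- The operator `b² d/db` on `ℂ[[b]]`; the variable `b` is `PowerSeries.X`. -/
def bbD (S : ℂ⟦X⟧) : ℂ⟦X⟧ := PowerSeries.X ^ 2 * PowerSeries.derivative ℂ S

theorem bbD_add (S T : ℂ⟦X⟧) : bbD (S + T) = bbD S + bbD T := by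
  simp [bbD, mul_add]

theorem bbD_mul (S T : ℂ⟦X⟧) : bbD (S * T) = S * bbD T + bbD S * T := by
  simp only [bbD, Derivation.leibniz, smul_eq_mul]; ring

/-- The action of `a` on a `ℂ[[b]]`-module. The relation `a S = S a + b² S'` for all `S ∈ ℂ[[b]]`
says that `a` is `ℂ`-linear (`S` constant) and that `a b - b a = b²` (`S = b`); for general `S` it
is the same relation extended by `b`-adic continuity, and it holds automatically on a free module
of finite rank. An (a,b)-module is a free `ℂ[[b]]`-module of finite rank with such an action. -/
class ABModule (E : Type u) [AddCommGroup E] [Module ℂ⟦X⟧ E] where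
  /-- the operator `a` -/
  a : E →+ E
  a_smul : ∀ (S : ℂ⟦X⟧) (x : E), a (S • x) = S • a x + bbD S • x

/-- The operator `a`. -/
abbrev opA {E : Type u} [AddCommGroup E] [Module ℂ⟦X⟧ E] [ABModule E] : E →+ E := ABModule.a

/-- The rank one (a,b)-module `E_δ = ℂ[[b]] e_δ` with `a e_δ = δ b e_δ`;
the series `S` stands for `S e_δ`. -/
def RankOne (_δ : ℚ) : Type := ℂ⟦X⟧

instance (δ : ℚ) : AddCommGroup (RankOne δ) := inferInstanceAs (AddCommGroup ℂ⟦X⟧)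

instance (δ : ℚ) : Module ℂ⟦X⟧ (RankOne δ) := inferInstanceAs (Module ℂ⟦X⟧ ℂ⟦X⟧)

/-- The series `S`, for the element `S e_δ` of `E_δ`. -/
def RankOne.series {δ : ℚ} (x : RankOne δ) : ℂ⟦X⟧ := x

/-- The coefficient of `e_δ` in `a (S e_δ)`. -/
def rankOneA (δ : ℚ) (S : ℂ⟦X⟧) : ℂ⟦X⟧ := bbD S + PowerSeries.C (δ : ℂ) * PowerSeries.X * S

theorem rankOneA_add (δ : ℚ) (S T : ℂ⟦X⟧) :
    rankOneA δ (S + T) = rankOneA δ S + rankOneA δ T := by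
  simp only [rankOneA, bbD_add]; ring

theorem rankOneA_mul (δ : ℚ) (S T : ℂ⟦X⟧) :
    rankOneA δ (S * T) = S * rankOneA δ T + bbD S * T := by
  simp only [rankOneA, bbD_mul]; ring

instance (δ : ℚ) : ABModule (RankOne δ) where
  a := AddMonoidHom.mk' (M := RankOne δ) (rankOneA δ) (rankOneA_add δ)
  a_smul := rankOneA_mul δ

section Constructions

variable {E : Type u} [AddCommGroup E] [Module ℂ⟦X⟧ E] [ABModule E]
variable {F : Type v} [AddCommGroup F] [Module ℂ⟦X⟧ F] [ABModule F]

/-- `Hom_{a,b}(E, F)`: the `ℂ[[b]]`-linear maps, with `(a f)(x) = a (f x) - f (a x)`. -/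
instance instABModuleHom : ABModule (E →ₗ[ℂ⟦X⟧] F) where
  a := AddMonoidHom.mk' (fun f =>
      { toFun := fun x => opA (f x) - f (opA x)
        map_add' := fun x y => by simp only [map_add]; abel
        map_smul' := fun S x => by
          simp only [map_smul, ABModule.a_smul, map_add, RingHom.id_apply, smul_sub]; abel })
    (fun f g => by
      ext x
      simp only [LinearMap.add_apply, LinearMap.coe_mk, AddHom.coe_mk, map_add]; abel)
  a_smul S f := by
    ext x
    simp only [AddMonoidHom.mk'_apply, LinearMap.add_apply, LinearMap.smul_apply,
      LinearMap.coe_mk, AddHom.coe_mk, ABModule.a_smul, smul_sub]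
    abel

/-- `E ⊗_{a,b} F`: the tensor product over `ℂ[[b]]`,
with `a (x ⊗ y) = a x ⊗ y + x ⊗ a y`. -/
def tensorA : E ⊗[ℂ⟦X⟧] F →+ E ⊗[ℂ⟦X⟧] F :=
  TensorProduct.liftAddHom
    (AddMonoidHom.mk' (fun x : E =>
        AddMonoidHom.mk' (fun y : F => opA x ⊗ₜ[ℂ⟦X⟧] y + x ⊗ₜ[ℂ⟦X⟧] opA y)
          (fun y z => by simp only [map_add, TensorProduct.tmul_add]; abel))
      (fun x y => by
        ext z
        simp only [AddMonoidHom.mk'_apply, AddMonoidHom.add_apply, map_add,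
          TensorProduct.add_tmul]
        abel))
    (fun S x y => by
      simp only [AddMonoidHom.mk'_apply, ABModule.a_smul, TensorProduct.add_tmul,
        TensorProduct.tmul_add, TensorProduct.smul_tmul]
      abel)

theorem tensorA_tmul (x : E) (y : F) :
    tensorA (x ⊗ₜ[ℂ⟦X⟧] y) = opA x ⊗ₜ[ℂ⟦X⟧] y + x ⊗ₜ[ℂ⟦X⟧] opA y := rfl

instance instABModuleTensor : ABModule (E ⊗[ℂ⟦X⟧] F) where
  a := tensorA
  a_smul S t := by
    induction t with
    | zero => simp
    | tmul x y =>
      rw [TensorProduct.smul_tmul', tensorA_tmul, tensorA_tmul, ABModule.a_smul]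
      simp only [TensorProduct.add_tmul, smul_add, TensorProduct.smul_tmul']
      abel
    | add s t hs ht => simp only [smul_add, map_add, hs, ht]; abel

end Constructions

/-- The dual (a,b)-module `E* = Hom_{a,b}(E, E_0)`. -/
abbrev ABDual (E : Type u) [AddCommGroup E] [Module ℂ⟦X⟧ E] : Type u := E →ₗ[ℂ⟦X⟧] RankOne 0

/-! ### Asymptotic expansions and themes -/

/-- `Ξ_Λ^{(n-1)} = ⊕_{l ∈ Λ} ⊕_{j < n} ℂ[[b]] e_{l,j}`, where `e_{l,j}` stands for
`s^{l-1} (Log s)^j / j!`. An element is given by its coefficients. -/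
abbrev Xi (Λ : Finset ℚ) (n : ℕ) : Type := Λ → Fin n → ℂ⟦X⟧

/-- The coefficients of `a φ`, where `a e_{l,0} = l b e_{l,0}` and
`a e_{l,j} = l b e_{l,j} + b e_{l,j-1}` for `j ≥ 1`. -/
def xiA {Λ : Finset ℚ} {n : ℕ} (φ : Xi Λ n) : Xi Λ n := fun l j =>
  bbD (φ l j) + PowerSeries.C ((l : ℚ) : ℂ) * PowerSeries.X * φ l j +
    if h : (j : ℕ) + 1 < n then PowerSeries.X * φ l ⟨j + 1, h⟩ else 0

instance instABModuleXi (Λ : Finset ℚ) (n : ℕ) : ABModule (Xi Λ n) where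
  a := AddMonoidHom.mk' xiA (fun φ ψ => by
    funext l j
    simp only [xiA, Pi.add_apply, bbD_add]
    split_ifs <;> ring)
  a_smul S φ := by
    funext l j
    simp only [AddMonoidHom.mk'_apply, xiA, Pi.add_apply, Pi.smul_apply, smul_eq_mul, bbD_mul]
    split_ifs <;> ring

/-- `E` is isomorphic, as an (a,b)-module, to the submodule of `Ξ_Λ^{(n-1)}` generated by
`φ, a φ, a² φ, …`. -/
def IsGeneratedBy (E : Type u) [AddCommGroup E] [Module ℂ⟦X⟧ E] [ABModule E]
    {Λ : Finset ℚ} {n : ℕ} (φ : Xi Λ n) : Prop :=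
  ∃ ι : E →ₗ[ℂ⟦X⟧] Xi Λ n, Function.Injective ι ∧ (∀ x, ι (opA x) = opA (ι x)) ∧
    LinearMap.range ι = Submodule.span ℂ⟦X⟧ (Set.range fun ν : ℕ => opA^[ν] φ)

/-- Themes: the (a,b)-modules isomorphic to a monogenic submodule of some `Ξ_Λ^{(N)}` with
`Λ ⊂ ]0,1] ∩ ℚ` finite. -/
def IsTheme (E : Type u) [AddCommGroup E] [Module ℂ⟦X⟧ E] [ABModule E] : Prop :=
  ∃ (Λ : Finset ℚ) (n : ℕ) (φ : Xi Λ n), (∀ l ∈ Λ, 0 < l ∧ l ≤ 1) ∧ IsGeneratedBy E φ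

/-- `[l]`-primitive themes, for `l ∈ ]0,1] ∩ ℚ`: those that embed in some `Ξ_l^{(N)}`. -/
def IsPrimitiveTheme (l : ℚ) (E : Type u) [AddCommGroup E] [Module ℂ⟦X⟧ E] [ABModule E] : Prop :=
  ∃ (n : ℕ) (φ : Xi {l} n), IsGeneratedBy E φ

/-! ### Reduced complex spaces -/

/-- A reduced complex space: a Hausdorff space `X` with a sheaf `𝒪_X` of algebras of complex
valued functions, locally isomorphic to a set `{w ∈ W | g w = 0}` of common zeros of finitely many
holomorphic functions on an open set `W ⊂ ℂⁿ`, with the functions that are locally restrictions of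
holomorphic functions of `n` variables. -/
class ReducedComplexSpace (X : TopCat.{u}) where
  t2 : T2Space X
  /-- the structure sheaf -/
  hol : TopCat.LocalPredicate fun _ : X => ℂ
  const_mem : ∀ (U : Opens X) (c : ℂ), hol.pred fun _ : U => c
  add_mem : ∀ {U : Opens X} {f g : U → ℂ}, hol.pred f → hol.pred g → hol.pred fun x => f x + g x
  mul_mem : ∀ {U : Opens X} {f g : U → ℂ}, hol.pred f → hol.pred g → hol.pred fun x => f x * g x
  chart : ∀ x : X, ∃ (U : Opens X) (n m : ℕ) (W : Set (Fin n → ℂ))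
    (g : (Fin n → ℂ) → (Fin m → ℂ)) (z : U → (Fin n → ℂ)),
    x ∈ U ∧ IsOpen W ∧ DifferentiableOn ℂ g W ∧ Topology.IsEmbedding z ∧
    Set.range z = {w | w ∈ W ∧ g w = 0} ∧
    ∀ (V : Opens X) (hV : V ≤ U) (f : V → ℂ), hol.pred f ↔
      ∀ y : V, ∃ (N : Set (Fin n → ℂ)) (G : (Fin n → ℂ) → ℂ),
        IsOpen N ∧ z ⟨y, hV y.2⟩ ∈ N ∧ DifferentiableOn ℂ G N ∧
        ∀ y' : V, z ⟨y', hV y'.2⟩ ∈ N → f y' = G (z ⟨y', hV y'.2⟩)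

section Sheaves

variable {X : TopCat.{u}} [ReducedComplexSpace X]

/-- Holomorphic functions on `U`, i.e. `f ∈ 𝒪_X(U)`. -/
abbrev IsHol {U : Opens X} (f : U → ℂ) : Prop := (ReducedComplexSpace.hol (X := X)).pred f

/-- Sections of `𝒪_X[[b]]` on `U`: all the coefficients are in `𝒪_X(U)`. -/
def IsHolSeries {U : Opens X} (F : U → ℂ⟦X⟧) : Prop :=
  ∀ n : ℕ, IsHol fun x : U => PowerSeries.coeff n (F x)

theorem IsHol.sum {U : Opens X} {ι : Type*} (s : Finset ι) {f : ι → U → ℂ}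
    (h : ∀ i ∈ s, IsHol (f i)) : IsHol fun x => ∑ i ∈ s, f i x := by
  classical
  induction s using Finset.induction_on with
  | empty => simpa using ReducedComplexSpace.const_mem U 0
  | insert i s hi ih =>
    simp only [Finset.sum_insert hi]
    exact ReducedComplexSpace.add_mem (h i (by simp)) (ih fun j hj => h j (by simp [hj]))

theorem IsHolSeries.add {U : Opens X} {F G : U → ℂ⟦X⟧} (hF : IsHolSeries F)
    (hG : IsHolSeries G) : IsHolSeries fun x => F x + G x := fun n => by
  simpa using ReducedComplexSpace.add_mem (hF n) (hG n)

theorem IsHolSeries.sum {U : Opens X} {ι : Type*} (s : Finset ι) {F : ι → U → ℂ⟦X⟧}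
    (h : ∀ i ∈ s, IsHolSeries (F i)) : IsHolSeries fun x => ∑ i ∈ s, F i x := fun n => by
  simpa using IsHol.sum s fun i hi => h i hi n

theorem IsHolSeries.mul {U : Opens X} {F G : U → ℂ⟦X⟧} (hF : IsHolSeries F)
    (hG : IsHolSeries G) : IsHolSeries fun x => F x * G x := fun n => by
  simp only [PowerSeries.coeff_mul]
  exact IsHol.sum _ fun p _ => ReducedComplexSpace.mul_mem (hF p.1) (hG p.2)

theorem IsHolSeries.const (U : Opens X) (S : ℂ⟦X⟧) : IsHolSeries fun _ : U => S :=
  fun _ => ReducedComplexSpace.const_mem _ _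

theorem IsHolSeries.derivative {U : Opens X} {F : U → ℂ⟦X⟧} (hF : IsHolSeries F) :
    IsHolSeries fun x => PowerSeries.derivative ℂ (F x) := fun n => by
  simp only [PowerSeries.coeff_derivative]
  exact ReducedComplexSpace.mul_mem (hF _) (ReducedComplexSpace.const_mem _ _)

theorem IsHolSeries.bbD {U : Opens X} {F : U → ℂ⟦X⟧} (hF : IsHolSeries F) :
    IsHolSeries fun x => bbD (F x) := (IsHolSeries.const U _).mul hF.derivative

theorem IsHolSeries.res {U V : Opens X} (h : V ≤ U) {F : U → ℂ⟦X⟧} (hF : IsHolSeries F) :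
    IsHolSeries fun x : V => F ⟨x, h x.2⟩ := fun n =>
  ReducedComplexSpace.hol.res h.hom _ (hF n)

theorem IsHolSeries.locality {U : Opens X} {F : U → ℂ⟦X⟧}
    (h : ∀ x : U, ∃ (V : Opens X) (_ : x.1 ∈ V) (hV : V ≤ U),
      IsHolSeries fun y : V => F ⟨y, hV y.2⟩) : IsHolSeries F := fun n =>
  ReducedComplexSpace.hol.locality _ fun x =>
    let ⟨V, hx, hV, hF⟩ := h x
    ⟨V, hx, hV.hom, hF n⟩

end Sheaves

/-! ### Sheaves of `𝒪_X`-(a,b)-modules -/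

/-- A sheaf of `𝒪_X`-(a,b)-modules on a reduced complex space: a locally free sheaf `𝔼` of finite
type of `𝒪_X[[b]]`-modules with an action of `a`. As `X` is reduced, a section of such a sheaf is
determined by its values in the fibres `E(x) = 𝔼 / ℳ_x[[b]] 𝔼`, so `𝔼` is given as a subsheaf of
the sheaf of all functions `x ↦ s(x) ∈ E(x)`: locally there are sections `e_1, …, e_k` whose values
are bases of all the fibres, and the sections are the combinations of `e_1, …, e_k` with
coefficients in `𝒪_X[[b]]`. -/
structure ABSheaf (X : TopCat.{u}) [ReducedComplexSpace X] where
  /-- the fibres `E(x)` -/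
  fiber : X → Type v
  [addCommGroup : ∀ x, AddCommGroup (fiber x)]
  [module : ∀ x, Module ℂ⟦X⟧ (fiber x)]
  [abModule : ∀ x, ABModule (fiber x)]
  /-- the sections of `𝔼` -/
  sec : TopCat.LocalPredicate fiber
  a_mem : ∀ {U : Opens X} {s : ∀ x : U, fiber x}, sec.pred s → sec.pred fun x : U => opA (s x)
  locally_free : ∀ x : X, ∃ (U : Opens X) (k : ℕ) (e : ∀ y : U, Module.Basis (Fin k) ℂ⟦X⟧ (fiber y)),
    x ∈ U ∧ ∀ (V : Opens X) (hV : V ≤ U) (s : ∀ y : V, fiber y), sec.pred s ↔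
      ∃ c : Fin k → V → ℂ⟦X⟧, (∀ i, IsHolSeries (c i)) ∧
        ∀ y : V, s y = ∑ i, c i y • e ⟨y, hV y.2⟩ i

attribute [instance] ABSheaf.addCommGroup ABSheaf.module ABSheaf.abModule

section Families

variable {X : TopCat.{u}} [ReducedComplexSpace X]

/-- A holomorphic map `φ : U → Ξ_Λ^{(n-1)}`, i.e. a section on `U` of `⊕_{l,j} 𝒪_X[[b]] e_{l,j}`. -/
def IsHolXi {U : Opens X} {Λ : Finset ℚ} {n : ℕ} (φ : U → Xi Λ n) : Prop :=
  ∀ (l : Λ) (j : Fin n), IsHolSeries fun x : U => φ x l j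

/-- `φ` is a `k`-thematic holomorphic map on `U`: the sheaf `𝔼_φ` generated over `𝒪_X[[b]]` by
the `a^ν φ`, `ν ≥ 0`, is free with basis `φ, a φ, …, a^{k-1} φ`, and its fibre at each `x` is the
(a,b)-module generated by `φ(x)`, of rank `k`. -/
def IsThematic (k : ℕ) {U : Opens X} {Λ : Finset ℚ} {n : ℕ} (φ : U → Xi Λ n) : Prop :=
  IsHolXi φ ∧
  (∀ x : U, LinearIndependent ℂ⟦X⟧ fun j : Fin k => opA^[(j : ℕ)] (φ x)) ∧
  ∀ ν : ℕ, ∃ c : Fin k → U → ℂ⟦X⟧, (∀ j, IsHolSeries (c j)) ∧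
    ∀ x : U, opA^[ν] (φ x) = ∑ j, c j x • opA^[(j : ℕ)] (φ x)

/-- The sections on `V ⊂ U` of the sheaf `𝔼_φ` of a `k`-thematic map `φ` on `U`. -/
def IsThematicSection (k : ℕ) {U : Opens X} {Λ : Finset ℚ} {n : ℕ} (φ : U → Xi Λ n)
    {V : Opens X} (hV : V ≤ U) (t : V → Xi Λ n) : Prop :=
  ∃ c : Fin k → V → ℂ⟦X⟧, (∀ j, IsHolSeries (c j)) ∧
    ∀ y : V, t y = ∑ j, c j y • opA^[(j : ℕ)] (φ ⟨y, hV y.2⟩)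

/-- `𝔼` is a holomorphic family of rank `k` themes: locally on `X` there are a finite set
`Λ ⊂ ]0,1] ∩ ℚ`, a `k`-thematic map `φ : U → Ξ_Λ^{(k-1)}` and an isomorphism `𝔼|_U ≃ 𝔼_φ` of
sheaves of `𝒪_X`-(a,b)-modules, given by its values on the fibres. -/
def ABSheaf.IsHolomorphicFamily (𝔼 : ABSheaf.{u, v} X) (k : ℕ) : Prop :=
  ∀ x : X, ∃ (U : Opens X) (Λ : Finset ℚ) (φ : U → Xi Λ k)
    (ι : ∀ y : U, 𝔼.fiber y →ₗ[ℂ⟦X⟧] Xi Λ k),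
    x ∈ U ∧ (∀ l ∈ Λ, 0 < l ∧ l ≤ 1) ∧ IsThematic k φ ∧
    (∀ y : U, Function.Injective (ι y)) ∧
    (∀ (y : U) (e : 𝔼.fiber y), ι y (opA e) = opA (ι y e)) ∧
    ∀ (V : Opens X) (hV : V ≤ U) (t : V → Xi Λ k), IsThematicSection k φ hV t ↔
      ∃ s : ∀ y : V, 𝔼.fiber y, 𝔼.sec.pred s ∧ ∀ y : V, ι ⟨y, hV y.2⟩ (s y) = t y

/-- The sections over `U` of the sheaf `𝔼* = ℋom(𝔼, 𝒪_X[[b]])`: the families of linear forms on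
the fibres that map sections of `𝔼` to sections of `𝒪_X[[b]]`. -/
def ABSheaf.dualSec (𝔼 : ABSheaf.{u, v} X) :
    TopCat.LocalPredicate fun x : X => ABDual (𝔼.fiber x) where
  pred {U} σ := ∀ (V : Opens X) (hV : V ≤ U) (s : ∀ y : V, 𝔼.fiber y), 𝔼.sec.pred s →
    IsHolSeries fun y : V => (σ ⟨y, hV y.2⟩ (s y)).series
  res {_ _} i σ h V hV s hs := h V (hV.trans i.le) s hs
  locality {U} σ h V hV s hs := by
    apply IsHolSeries.locality
    intro x
    obtain ⟨W, hxW, i, hW⟩ := h ⟨x, hV x.2⟩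
    exact ⟨V ⊓ W, ⟨x.2, hxW⟩, inf_le_left, hW (V ⊓ W) inf_le_right
      (fun y => s ⟨y, y.2.1⟩) (𝔼.sec.res (inf_le_left (b := W)).hom _ hs)⟩

/-- The dual basis. -/
def dualB {E : Type v} [AddCommGroup E] [Module ℂ⟦X⟧ E] {k : ℕ}
    (e : Module.Basis (Fin k) ℂ⟦X⟧ E) : Module.Basis (Fin k) ℂ⟦X⟧ (ABDual E) := e.dualBasis

theorem dualB_pairing {E : Type v} [AddCommGroup E] [Module ℂ⟦X⟧ E] {k : ℕ}
    (e : Module.Basis (Fin k) ℂ⟦X⟧ E) (c d : Fin k → ℂ⟦X⟧) :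
    ((∑ i, c i • dualB e i) (∑ j, d j • e j)).series = ∑ i, c i * d i := by
  change (∑ i, c i • e.dualBasis i : Module.Dual ℂ⟦X⟧ E) (∑ j, d j • e j) = _
  simp [LinearMap.sum_apply, Finsupp.single_apply, mul_comm]

theorem dualB_expand {E : Type v} [AddCommGroup E] [Module ℂ⟦X⟧ E] {k : ℕ}
    (e : Module.Basis (Fin k) ℂ⟦X⟧ E) (σ : ABDual E) :
    σ = ∑ i, (σ (e i)).series • dualB e i := by
  refine e.ext fun j => ?_
  have h := dualB_pairing e (fun i => (σ (e i)).series) (Pi.single j 1)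
  simp only [Pi.single_apply, ite_smul, one_smul, zero_smul, Finset.sum_ite_eq',
    Finset.mem_univ, if_true, mul_ite, mul_one, mul_zero] at h
  exact h.symm

/-- The dual family `E(x)*`, `x ∈ X`. -/
def ABSheaf.dual (𝔼 : ABSheaf.{u, v} X) : ABSheaf.{u, v} X where
  fiber x := ABDual (𝔼.fiber x)
  sec := 𝔼.dualSec
  a_mem {U σ} h V hV s hs := by
    have h1 : IsHolSeries fun y : V => rankOneA 0 (σ ⟨y, hV y.2⟩ (s y)).series :=
      (h V hV s hs).bbD.add ((IsHolSeries.const V _).mul (h V hV s hs))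
    have h2 : IsHolSeries fun y : V => (σ ⟨y, hV y.2⟩ (opA (s y))).series :=
      h V hV (fun y => opA (s y)) (𝔼.a_mem hs)
    have h3 := h1.add ((IsHolSeries.const V (-1)).mul h2)
    have h4 : ∀ A B : ℂ⟦X⟧, A + -1 * B = A - B := fun A B => by ring
    have h5 : (fun y : V => ((opA (σ ⟨y, hV y.2⟩)) (s y)).series) = fun y : V =>
        rankOneA 0 (σ ⟨y, hV y.2⟩ (s y)).series + -1 * (σ ⟨y, hV y.2⟩ (opA (s y))).series :=
      funext fun y => (h4 _ _).symm
    change IsHolSeries fun y : V => ((opA (σ ⟨y, hV y.2⟩)) (s y)).series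
    rw [h5]
    exact h3
  locally_free x := by
    obtain ⟨U, k, e, hx, he⟩ := 𝔼.locally_free x
    refine ⟨U, k, fun y => dualB (e y), hx, fun V hV σ => ⟨fun h => ?_, ?_⟩⟩
    · refine ⟨fun i y => (σ y (e ⟨y, hV y.2⟩ i)).series, fun i => ?_,
        fun y => dualB_expand (e ⟨y, hV y.2⟩) (σ y)⟩
      refine h V le_rfl (fun y => e ⟨y, hV y.2⟩ i) ((he V hV _).2
        ⟨fun j _ => if j = i then 1 else 0, fun j => IsHolSeries.const V _, fun y => ?_⟩)
      simp
    · rintro ⟨c, hc, hσ⟩ W hW s hs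
      obtain ⟨d, hd, hsd⟩ := (he W (hW.trans hV) s).1 hs
      have h1 : IsHolSeries fun y : W => ∑ i, c i ⟨y, hW y.2⟩ * d i y :=
        IsHolSeries.sum _ fun i _ => ((hc i).res hW).mul (hd i)
      have h2 : (fun y : W => (σ ⟨y, hW y.2⟩ (s y)).series) =
          fun y : W => ∑ i, c i ⟨y, hW y.2⟩ * d i y := by
        funext y
        rw [hσ, hsd]
        exact dualB_pairing (e ⟨y, hV (hW y.2)⟩) (fun i => c i ⟨y, hW y.2⟩) (fun i => d i y)
      rw [h2]
      exact h1

/-- `x ⊗ S e_δ ↦ S x`, the `ℂ[[b]]`-linear isomorphism `E ⊗ E_δ ≃ E`. -/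
def untwist (δ : ℚ) (E : Type v) [AddCommGroup E] [Module ℂ⟦X⟧ E] :
    E ⊗[ℂ⟦X⟧] RankOne δ ≃ₗ[ℂ⟦X⟧] E := TensorProduct.rid ℂ⟦X⟧ E

theorem untwist_tmul (δ : ℚ) (E : Type v) [AddCommGroup E] [Module ℂ⟦X⟧ E] (x : E)
    (S : RankOne δ) : untwist δ E (x ⊗ₜ[ℂ⟦X⟧] S) = S.series • x := rfl

theorem untwist_a (δ : ℚ) (E : Type v) [AddCommGroup E] [Module ℂ⟦X⟧ E] [ABModule E]
    (t : E ⊗[ℂ⟦X⟧] RankOne δ) :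
    untwist δ E (opA t) = opA (untwist δ E t) +
      (PowerSeries.C (δ : ℂ) * PowerSeries.X) • untwist δ E t := by
  induction t with
  | zero => simp
  | tmul x S =>
    change untwist δ E (tensorA (x ⊗ₜ[ℂ⟦X⟧] S)) = _
    rw [tensorA_tmul, map_add, untwist_tmul, untwist_tmul, untwist_tmul, ABModule.a_smul]
    change _ + rankOneA δ S.series • x = _
    rw [rankOneA, add_smul, mul_smul _ S.series, add_assoc]
  | add s t hs ht => simp only [map_add, hs, ht, smul_add]; abel

theorem ABSheaf.add_mem (𝔼 : ABSheaf.{u, v} X) {U : Opens X} {s t : ∀ x : U, 𝔼.fiber x}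
    (hs : 𝔼.sec.pred s) (ht : 𝔼.sec.pred t) : 𝔼.sec.pred fun x => s x + t x := by
  apply 𝔼.sec.locality
  intro x
  obtain ⟨W, k, e, hx, he⟩ := 𝔼.locally_free x.1
  refine ⟨U ⊓ W, ⟨x.2, hx⟩, (inf_le_left (b := W)).hom, (he _ inf_le_right _).2 ?_⟩
  obtain ⟨c, hc, hsc⟩ := (he _ inf_le_right _).1 (𝔼.sec.res (inf_le_left (b := W)).hom _ hs)
  obtain ⟨d, hd, htd⟩ := (he _ inf_le_right _).1 (𝔼.sec.res (inf_le_left (b := W)).hom _ ht)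
  refine ⟨fun i y => c i y + d i y, fun i => (hc i).add (hd i), fun y => ?_⟩
  simp only [add_smul, Finset.sum_add_distrib, ← hsc, ← htd]

theorem ABSheaf.smul_mem (𝔼 : ABSheaf.{u, v} X) {U : Opens X} {F : U → ℂ⟦X⟧}
    {s : ∀ x : U, 𝔼.fiber x} (hF : IsHolSeries F) (hs : 𝔼.sec.pred s) :
    𝔼.sec.pred fun x => F x • s x := by
  apply 𝔼.sec.locality
  intro x
  obtain ⟨W, k, e, hx, he⟩ := 𝔼.locally_free x.1
  refine ⟨U ⊓ W, ⟨x.2, hx⟩, (inf_le_left (b := W)).hom, (he _ inf_le_right _).2 ?_⟩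
  obtain ⟨c, hc, hsc⟩ := (he _ inf_le_right _).1 (𝔼.sec.res (inf_le_left (b := W)).hom _ hs)
  refine ⟨fun i y => F ⟨y, y.2.1⟩ * c i y,
    fun i => (hF.res (inf_le_left (b := W))).mul (hc i), fun y => ?_⟩
  simp only [mul_smul, ← Finset.smul_sum, ← hsc]
  rfl

/-- The family `E(x) ⊗_{a,b} E_δ`, `x ∈ X`: its sections are the `s ⊗ e_δ`, `s` a section
of `𝔼`. -/
def ABSheaf.twist (𝔼 : ABSheaf.{u, v} X) (δ : ℚ) : ABSheaf.{u, v} X where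
  fiber x := 𝔼.fiber x ⊗[ℂ⟦X⟧] RankOne δ
  sec :=
    { pred := fun {U} σ => 𝔼.sec.pred fun x : U => untwist δ (𝔼.fiber x) (σ x)
      res := fun i _ h => 𝔼.sec.res i _ h
      locality := fun _ h => 𝔼.sec.locality _ h }
  a_mem h := by
    simp only [untwist_a]
    exact 𝔼.add_mem (𝔼.a_mem h) (𝔼.smul_mem (IsHolSeries.const _ _) h)
  locally_free x := by
    obtain ⟨U, k, e, hx, he⟩ := 𝔼.locally_free x
    refine ⟨U, k, fun y => (e y).map (untwist δ _).symm, hx, fun V hV σ => ?_⟩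
    refine (he V hV _).trans (exists_congr fun c => and_congr_right fun _ =>
      forall_congr' fun y => ?_)
    rw [← (untwist δ (𝔼.fiber y)).injective.eq_iff (a := σ y)]
    simp

end Families

end Themes

end

open Themes
open scoped TensorProduct

/-
The coordinates of an embedding `E(x) → Ξ_l`, taken in reverse order and with alternating signs,
form a Jordan chain `u_0, …, u_{k-1}` of `a` in `E(x)* ⊗ E_δ`, of exponent `δ - l`. An embedding of
this fibre in some `Ξ_Λ` maps the chain to `b^q` times constant vectors, where `δ - l = q + l'` with
`0 < l' ≤ 1`, so that there is an embedding `κ_x` in `Ξ_{l'}` with `κ_x(u_j) = b^q e_{l',j}`. By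
Cramer's rule `κ_x` is holomorphic in `x` where the order in `b` of the determinant of the chain in
a frame is locally constant. It always is: the determinant satisfies an equation
`b² d' = T d` with `T` holomorphic in `x`, and the coefficient of `b` in `T` is the order of `d`.
Finally a generator of a fibre extends to a section whose first `k` iterates under `a` form a frame,
as `a` is linear modulo `b`, where Cayley–Hamilton and Nakayama apply.
-/

noncomputable section

namespace Themes

open scoped Matrix

section Derivation

variable {R A : Type*} [CommRing R] [CommRing A] [Algebra R A] (D : Derivation R A A)

theorem derivation_prod {ι : Type*} [DecidableEq ι] (s : Finset ι) (f : ι → A) :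
    D (∏ i ∈ s, f i) = ∑ i ∈ s, (∏ j ∈ s.erase i, f j) * D (f i) := by
  induction s using Finset.induction_on with
  | empty => simp
  | insert i s hi ih =>
    rw [Finset.prod_insert hi, D.leibniz, ih, Finset.sum_insert hi, Finset.erase_insert hi,
      add_comm]
    simp only [smul_eq_mul, Finset.mul_sum]
    congr 1
    refine Finset.sum_congr rfl fun j hj => ?_
    rw [Finset.erase_insert_of_ne (ne_of_mem_of_not_mem hj hi).symm,
      Finset.prod_insert (by simp [hi]), mul_assoc]

theorem derivation_det {n : Type*} [Fintype n] [DecidableEq n] (M : Matrix n n A) :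
    D M.det = (M.adjugate * M.map D).trace := by
  have replaceCol : ∀ i, (M.adjugate * M.map D) i i = (M.updateCol i fun p => D (M p i)).det :=
    fun i => by
      rw [← Matrix.cramer_apply, Matrix.cramer_eq_adjugate_mulVec]
      simp [Matrix.mul_apply, Matrix.mulVec, dotProduct]
  simp only [Matrix.trace, Matrix.diag_apply, replaceCol, Matrix.det_apply', map_sum]
  rw [Finset.sum_comm]
  refine Finset.sum_congr rfl fun σ _ => ?_
  rw [D.leibniz, D.map_intCast, smul_zero, add_zero, derivation_prod, smul_eq_mul, Finset.mul_sum]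
  refine Finset.sum_congr rfl fun i _ => ?_
  rw [← Finset.prod_erase_mul _ _ (Finset.mem_univ i), Matrix.updateCol_self]
  congr 2
  exact Finset.prod_congr rfl fun j hj => by
    rw [Matrix.updateCol_ne (Finset.ne_of_mem_erase hj)]

end Derivation

section Determinant

variable {ι R M : Type*} [Fintype ι] [CommRing R] [AddCommGroup M] [Module R M]

theorem toMatrix_mulVec (e : Module.Basis ι R M) (u : ι → M) (c : ι → R) :
    e.toMatrix u *ᵥ c = e.repr (∑ j, c j • u j) := by
  ext i
  simp [Matrix.mulVec, dotProduct, Module.Basis.toMatrix_apply, mul_comm]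

variable [DecidableEq ι]

theorem det_toMatrix_smul (e : Module.Basis ι R M) (u : ι → M) (x : M) :
    (e.toMatrix u).det • x = ∑ j, ((e.toMatrix u).adjugate *ᵥ e.repr x) j • u j := by
  apply e.repr.injective
  apply DFunLike.coe_injective
  rw [← toMatrix_mulVec, Matrix.mulVec_mulVec, Matrix.mul_adjugate, Matrix.smul_mulVec,
    Matrix.one_mulVec, map_smul, Finsupp.coe_smul]

theorem det_toMatrix_mul_repr (e e' : Module.Basis ι R M) (x : M) (j : ι) :
    (e.toMatrix e').det * e'.repr x j = ((e.toMatrix e').adjugate *ᵥ e.repr x) j := by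
  rw [← smul_eq_mul, ← Finsupp.smul_apply, ← map_smul, det_toMatrix_smul]
  simp [Finsupp.single_apply]

theorem det_toMatrix_ne_zero [IsDomain R] (e : Module.Basis ι R M) {u : ι → M}
    (hu : LinearIndependent R u) :
    (e.toMatrix u).det ≠ 0 := by
  intro h
  obtain ⟨c, hc, h0⟩ := Matrix.exists_mulVec_eq_zero_iff.2 h
  refine hc (funext (Fintype.linearIndependent_iff.1 hu c (e.repr.injective ?_)))
  apply DFunLike.coe_injective
  rw [← toMatrix_mulVec, h0, map_zero, Finsupp.coe_zero]

end Determinant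

section MaximalRank

variable {ι R M N : Type*} [Finite ι] [CommRing R] [IsDomain R]
  [AddCommGroup M] [Module R M] [AddCommGroup N] [Module R N]

theorem linearMap_ext_of_linearIndependent [Module.IsTorsionFree R N] (e : Module.Basis ι R M)
    {u : ι → M} (hu : LinearIndependent R u) {f g : M →ₗ[R] N} (h : ∀ j, f (u j) = g (u j)) :
    f = g := by
  classical
  have := Fintype.ofFinite ι
  ext x
  apply smul_right_injective N (det_toMatrix_ne_zero e hu)
  simp only [← map_smul f, ← map_smul g, det_toMatrix_smul e u x]
  simp only [map_sum, map_smul, h]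

theorem lcomp_injective {P : Type*} [AddCommGroup P] [Module R P] [Module.IsTorsionFree R P]
    (e : Module.Basis ι R M) (e' : Module.Basis ι R N) {f : M →ₗ[R] N}
    (hf : Function.Injective f) : Function.Injective (LinearMap.lcomp R P f) := fun _ _ h =>
  linearMap_ext_of_linearIndependent e' (e.linearIndependent.map' f (LinearMap.ker_eq_bot.2 hf))
    fun j => LinearMap.congr_fun h (e j)

theorem injective_of_linearIndependent_comp (e : Module.Basis ι R M) {u : ι → M}
    {f : M →ₗ[R] N} (hf : LinearIndependent R (f ∘ u)) : Function.Injective f := by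
  classical
  have := Fintype.ofFinite ι
  have : Module.IsTorsionFree R M := e.repr.injective.moduleIsTorsionFree _ (by simp)
  have hdet := det_toMatrix_ne_zero e (hf.of_comp f)
  refine (injective_iff_map_eq_zero f).2 fun x hx => ?_
  have hc := congrArg f (det_toMatrix_smul e u x)
  rw [map_smul, hx, smul_zero, map_sum] at hc
  simp only [map_smul] at hc
  have h0 := Fintype.linearIndependent_iff.1 hf _ hc.symm
  refine (smul_eq_zero.1 ?_).resolve_left hdet
  simpa only [h0, zero_smul, Finset.sum_const_zero] using det_toMatrix_smul e u x

end MaximalRank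

section CayleyHamilton

variable {R M : Type*} [CommRing R] [Nontrivial R] [AddCommGroup M] [Module R M]
  [Module.Free R M] [Module.Finite R M]

theorem pow_apply_mem_span_iterates (A : Module.End R M) (ν : ℕ) (x : M) :
    (A ^ ν) x ∈ Submodule.span R
      (Set.range fun j : Fin (Module.finrank R M) => (A ^ (j : ℕ)) x) := by
  rw [LinearMap.pow_eq_aeval_mod_charpoly]
  set p := Polynomial.X ^ ν %ₘ A.charpoly
  have hp : p.degree < Module.finrank R M := by
    rw [← LinearMap.charpoly_natDegree A, ← Polynomial.degree_eq_natDegree A.charpoly_monic.ne_zero]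
    exact Polynomial.degree_modByMonic_lt _ A.charpoly_monic
  rw [Polynomial.aeval_eq_sum_range, LinearMap.sum_apply]
  refine Submodule.sum_mem _ fun i _ => ?_
  by_cases hi : i < Module.finrank R M
  · exact Submodule.smul_mem _ _ (Submodule.subset_span ⟨⟨i, hi⟩, rfl⟩)
  · rw [Polynomial.coeff_eq_zero_of_degree_lt (hp.trans_le (by exact_mod_cast not_lt.1 hi)),
      zero_smul]
    exact Submodule.zero_mem _

end CayleyHamilton

section JordanBlock

/-- The upper triangular Jordan block of size `k` with eigenvalue `ρ`. -/
def jordanBlock {R : Type*} [Zero R] [One R] (ρ : R) (k : ℕ) : Matrix (Fin k) (Fin k) R :=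
  Matrix.of fun i j => if i = j then ρ else if (i : ℕ) + 1 = j then 1 else 0

variable {R : Type*}

theorem map_jordanBlock {S : Type*} [NonAssocSemiring R] [NonAssocSemiring S] (f : R →+* S)
    (ρ : R) {k : ℕ} (i j : Fin k) : f (jordanBlock ρ k i j) = jordanBlock (f ρ) k i j := by
  simp [jordanBlock, apply_ite f]

theorem jordanBlock_add [NonAssocSemiring R] (ρ σ : R) (k : ℕ) :
    jordanBlock (ρ + σ) k = jordanBlock ρ k + σ • (1 : Matrix (Fin k) (Fin k) R) := by
  ext i j
  by_cases h : i = j <;> simp [jordanBlock, h]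

theorem neg_jordanBlock_rev [Ring R] (ρ : R) {k : ℕ} (i j : Fin k) :
    -((-1) ^ (i + j : ℕ) * jordanBlock ρ k j.rev i.rev) = jordanBlock (-ρ) k i j := by
  have hij : (i : ℕ) + 1 = j → ((-1 : R)) ^ (i + j : ℕ) = -1 := fun h =>
    Odd.neg_one_pow ⟨i, by omega⟩
  have hrev : (j.rev : ℕ) + 1 = i.rev ↔ (i : ℕ) + 1 = j := by
    simp only [Fin.val_rev]; omega
  simp only [jordanBlock, Matrix.of_apply, hrev, Fin.rev_inj, eq_comm (a := j)]
  split_ifs with h h'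
  · simp [h, ← two_mul]
  · simp [hij h']
  · simp

theorem sum_jordanBlock_mul [NonAssocSemiring R] (ρ : R) {k : ℕ} (c : Fin k → R) (i : Fin k) :
    ∑ j, jordanBlock ρ k i j * c j =
      ρ * c i + if h : (i : ℕ) + 1 < k then c ⟨i + 1, h⟩ else 0 := by
  have split : ∀ j, jordanBlock ρ k i j * c j =
      (if i = j then ρ * c j else 0) + if (i : ℕ) + 1 = j then c j else 0 := fun j => by
    by_cases h : i = j <;> simp [jordanBlock, h]
  simp only [split, Finset.sum_add_distrib, Finset.sum_ite_eq, Finset.mem_univ, if_true]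
  congr 1
  split_ifs with h
  · rw [Finset.sum_eq_single ⟨i + 1, h⟩] <;> simp +contextual [Fin.ext_iff, eq_comm]
  · exact Finset.sum_eq_zero fun j _ => if_neg (by omega)

theorem sum_mul_jordanBlock [NonAssocSemiring R] (ρ : R) {k : ℕ} (c : Fin k → R) (j : Fin k) :
    ∑ i, c i * jordanBlock ρ k i j =
      c j * ρ + if h : 0 < (j : ℕ) then c ⟨j - 1, by omega⟩ else 0 := by
  have split : ∀ i, c i * jordanBlock ρ k i j =
      (if i = j then c i * ρ else 0) + if (i : ℕ) + 1 = j then c i else 0 := fun i => by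
    by_cases h : i = j <;> simp [jordanBlock, h]
  simp only [split, Finset.sum_add_distrib, Finset.sum_ite_eq', Finset.mem_univ, if_true]
  congr 1
  split_ifs with h
  · rw [Finset.sum_eq_single ⟨j - 1, by omega⟩]
    · simp; omega
    · intro i _ hi
      exact if_neg fun h' => hi (Fin.ext (by simp; omega))
    · simp
  · exact Finset.sum_eq_zero fun j _ => if_neg (by omega)

theorem eq_zero_of_jordanBlock_mul_eq [CommRing R] [IsDomain R] {ρ σ : R} (h : ρ ≠ σ) {n k : ℕ}
    {T : Matrix (Fin n) (Fin k) R} (hT : jordanBlock ρ n * T = T * jordanBlock σ k) : T = 0 := by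
  have entry : ∀ d (i : Fin n) (j : Fin k), n - i + j = d → T i j = 0 := by
    intro d
    induction d using Nat.strong_induction_on with
    | _ d ih =>
      intro i j hd
      have hij := congrFun (congrFun hT i) j
      rw [Matrix.mul_apply, Matrix.mul_apply, sum_jordanBlock_mul _ (T · j),
        sum_mul_jordanBlock _ (T i)] at hij
      have below : (if h : (i : ℕ) + 1 < n then T ⟨i + 1, h⟩ j else 0) = 0 := by
        split_ifs with hi
        · exact ih _ (by simp only; omega) _ _ rfl
        · rfl
      have left : (if h : 0 < (j : ℕ) then T i ⟨j - 1, by omega⟩ else 0) = 0 := by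
        split_ifs with hj
        · exact ih _ (by simp; omega) _ _ rfl
        · rfl
      rw [below, left, add_zero, add_zero, mul_comm] at hij
      exact (mul_eq_zero.1 (by linear_combination hij : T i j * (ρ - σ) = 0)).resolve_right
        (sub_ne_zero.2 h)
  exact Matrix.ext fun i j => entry _ i j rfl

theorem sum_C_jordanBlock_add_smul {M : Type*} [AddCommGroup M] [Module ℂ⟦X⟧ M] (ρ σ : ℂ) {k : ℕ}
    (u : Fin k → M) (j : Fin k) :
    ∑ i, (PowerSeries.C (jordanBlock (ρ + σ) k i j) * PowerSeries.X) • u i =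
      ∑ i, (PowerSeries.C (jordanBlock ρ k i j) * PowerSeries.X) • u i +
        (PowerSeries.C σ * PowerSeries.X) • u j := by
  simp only [jordanBlock_add, Matrix.add_apply, Matrix.smul_apply, Matrix.one_apply, smul_eq_mul,
    mul_ite, mul_one, mul_zero, map_add, add_mul, add_smul, Finset.sum_add_distrib]
  congr 1
  rw [Finset.sum_eq_single j] <;> simp +contextual

end JordanBlock

section Derivation

/-- The derivation `b² d/db` of `ℂ[[b]]`, that is `bbD`, bundled for Jacobi's formula. -/
def bbDerivation : Derivation ℂ ℂ⟦X⟧ ℂ⟦X⟧ :=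
  (PowerSeries.X ^ 2 : ℂ⟦X⟧) • PowerSeries.derivative ℂ

theorem bbDerivation_apply (S : ℂ⟦X⟧) : bbDerivation S = bbD S := rfl

theorem bbD_C (c : ℂ) : bbD (PowerSeries.C c) = 0 := by
  simp [bbD]

theorem bbD_zero : bbD 0 = 0 := by
  simp [bbD]

theorem coeff_succ_bbD (S : ℂ⟦X⟧) (n : ℕ) :
    PowerSeries.coeff (n + 1) (bbD S) = n * PowerSeries.coeff n S := by
  rw [bbD, PowerSeries.coeff_X_pow_mul']
  rcases n with _ | n
  · simp
  · simp [PowerSeries.coeff_derivative, mul_comm]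

theorem bbD_X_pow (m : ℕ) :
    bbD (PowerSeries.X ^ m) = PowerSeries.C (m : ℂ) * PowerSeries.X * PowerSeries.X ^ m := by
  ext n
  rcases n with _ | n
  · simp [bbD]
  · rw [coeff_succ_bbD, mul_assoc, PowerSeries.coeff_C_mul, PowerSeries.coeff_succ_X_mul,
      PowerSeries.coeff_X_pow]
    split_ifs with h <;> simp [h]

theorem X_dvd_bbD (S : ℂ⟦X⟧) : PowerSeries.X ∣ bbD S :=
  Dvd.intro _ (by rw [bbD, pow_two, mul_assoc])

end Derivation

section Xi

variable {Λ : Finset ℚ} {n : ℕ}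

theorem opA_apply (φ : Xi Λ n) (μ : Λ) (i : Fin n) : opA φ μ i =
    bbD (φ μ i) + PowerSeries.X *
      ∑ j, PowerSeries.C (jordanBlock ((μ : ℚ) : ℂ) n i j) * φ μ j := by
  simp only [map_jordanBlock]
  rw [sum_jordanBlock_mul]
  change bbD _ + _ * _ * _ + _ = _
  split_ifs <;> ring

theorem coeff_succ_opA_apply (φ : Xi Λ n) (μ : Λ) (m : ℕ) (i : Fin n) :
    PowerSeries.coeff (m + 1) (opA φ μ i) =
      ∑ j, jordanBlock ((m : ℂ) + ((μ : ℚ) : ℂ)) n i j * PowerSeries.coeff m (φ μ j) := by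
  rw [opA_apply, map_add, coeff_succ_bbD, PowerSeries.coeff_succ_X_mul, map_sum]
  simp only [PowerSeries.coeff_C_mul]
  rw [sum_jordanBlock_mul, sum_jordanBlock_mul]
  ring

end Xi

section JordanChain

variable {E : Type u} [AddCommGroup E] [Module ℂ⟦X⟧ E] [ABModule E]
variable {F : Type v} [AddCommGroup F] [Module ℂ⟦X⟧ F] [ABModule F]

/-- The maps compatible with `a`: with `ℂ[[b]]`-linearity, the morphisms of (a,b)-modules. -/
def CommutesWithA (f : E →ₗ[ℂ⟦X⟧] F) : Prop := ∀ x, f (opA x) = opA (f x)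

theorem CommutesWithA.comp {G : Type*} [AddCommGroup G] [Module ℂ⟦X⟧ G] [ABModule G]
    {g : F →ₗ[ℂ⟦X⟧] G} {f : E →ₗ[ℂ⟦X⟧] F} (hg : CommutesWithA g) (hf : CommutesWithA f) :
    CommutesWithA (g ∘ₗ f) := fun x => (congrArg g (hf x)).trans (hg (f x))

/-- A Jordan chain of exponent `ρ` for `b⁻¹ a`: `a u₀ = ρ b u₀` and
`a u_{j+1} = ρ b u_{j+1} + b u_j`. -/
def IsJordanChain (ρ : ℂ) {k : ℕ} (u : Fin k → F) : Prop :=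
  ∀ j, opA (u j) = ∑ i, (PowerSeries.C (jordanBlock ρ k i j) * PowerSeries.X) • u i

variable {ρ : ℂ} {k : ℕ}

theorem IsJordanChain.map {u : Fin k → E} (hu : IsJordanChain ρ u) {f : E →ₗ[ℂ⟦X⟧] F}
    (hf : CommutesWithA f) : IsJordanChain ρ (f ∘ u) := fun j => by
  rw [Function.comp_apply, ← hf, hu j, map_sum]
  simp only [map_smul, Function.comp_apply]

theorem IsJordanChain.X_pow_smul {u : Fin k → F} (hu : IsJordanChain ρ u) (q : ℕ) :
    IsJordanChain (ρ + q) fun j => (PowerSeries.X ^ q : ℂ⟦X⟧) • u j := fun j => by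
  rw [sum_C_jordanBlock_add_smul, ABModule.a_smul, bbD_X_pow, mul_smul _ (PowerSeries.X ^ q), hu j,
    Finset.smul_sum]
  simp only [smul_comm (PowerSeries.X ^ q : ℂ⟦X⟧)]

theorem IsJordanChain.exponent_eq {Λ : Finset ℚ} {n : ℕ} {u : Fin k → Xi Λ n}
    (hu : IsJordanChain ρ u) {m : ℕ} {j : Fin k} {μ : Λ} {i : Fin n}
    (h : PowerSeries.coeff m (u j μ i) ≠ 0) : (m : ℂ) + ((μ : ℚ) : ℂ) = ρ := by
  by_contra hne
  refine h (congrFun (congrFun (eq_zero_of_jordanBlock_mul_eq hne (n := n)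
    (T := Matrix.of fun p q => PowerSeries.coeff m (u q μ p)) (Matrix.ext fun p q => ?_)) i) j)
  have := congrArg (PowerSeries.coeff (m + 1)) (congrFun (congrFun (hu q) μ) p)
  rw [coeff_succ_opA_apply] at this
  simpa [Matrix.mul_apply, mul_assoc, PowerSeries.coeff_C_mul, PowerSeries.coeff_succ_X_mul,
    mul_comm (jordanBlock ρ k _ _)] using this

theorem IsJordanChain.commutesWithA [Module.IsTorsionFree ℂ⟦X⟧ F]
    (e : Module.Basis (Fin k) ℂ⟦X⟧ E) {u : Fin k → E} (hu : IsJordanChain ρ u)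
    (hu' : LinearIndependent ℂ⟦X⟧ u) {f : E →ₗ[ℂ⟦X⟧] F} (hf : IsJordanChain ρ (f ∘ u)) :
    CommutesWithA f := by
  have opA_eq_zero : opA f = 0 := linearMap_ext_of_linearIndependent e hu' fun j => by
    change opA (f (u j)) - f (opA (u j)) = 0
    have hfu := hf j
    simp only [Function.comp_apply] at hfu
    rw [hfu, hu j, map_sum]
    simp only [map_smul, sub_self]
  exact fun x => (sub_eq_zero.1 (LinearMap.congr_fun opA_eq_zero x)).symm

theorem commutesWithA_lcomp {f : E →ₗ[ℂ⟦X⟧] F} (hf : CommutesWithA f) :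
    CommutesWithA (LinearMap.lcomp ℂ⟦X⟧ (RankOne 0) f) := fun g => by
  ext x
  exact congrArg (fun y => opA (g (f x)) - g y) (hf x).symm

theorem IsJordanChain.untwist_symm {u : Fin k → E} (hu : IsJordanChain ρ u) (δ : ℚ) :
    IsJordanChain (ρ + (δ : ℂ)) ((untwist δ E).symm ∘ u) := fun j => by
  apply (untwist δ E).injective
  have := sum_C_jordanBlock_add_smul ρ (δ : ℂ) u j
  rw [untwist_a, map_sum]
  simp only [map_smul, Function.comp_apply, LinearEquiv.apply_symm_apply]
  rw [this, hu j]

end JordanChain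

section Xi

variable {l : ℚ} {k : ℕ}

/-- The element `b^q e_{l,j}` of `Ξ_l`. -/
def xiMonomial (l : ℚ) (q : ℕ) (j : Fin k) : Xi {l} k :=
  fun _ => Pi.single j (PowerSeries.X ^ q)

theorem xiMonomial_eq_smul (q : ℕ) (j : Fin k) :
    xiMonomial l q j = (PowerSeries.X ^ q : ℂ⟦X⟧) • xiMonomial l 0 j := by
  funext μ i
  simp [xiMonomial, Pi.single_apply]

theorem isJordanChain_xiMonomial (l : ℚ) (q k : ℕ) :
    IsJordanChain ((q : ℂ) + (l : ℂ)) (xiMonomial l q : Fin k → Xi {l} k) := by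
  have hzero : IsJordanChain (l : ℂ) (xiMonomial l 0 : Fin k → Xi {l} k) := fun j => by
    funext ⟨μ, hμ⟩ i
    obtain rfl := Finset.mem_singleton.1 hμ
    simp only [opA_apply, Finset.sum_apply, Pi.smul_apply, xiMonomial, pow_zero]
    rw [Pi.single_apply, apply_ite bbD, ← map_one PowerSeries.C, bbD_C, bbD_zero, ite_self]
    simp [Pi.single_apply, mul_comm]
  simpa only [← xiMonomial_eq_smul, add_comm] using hzero.X_pow_smul q

theorem linearIndependent_xiMonomial (l : ℚ) (q k : ℕ) :
    LinearIndependent ℂ⟦X⟧ (xiMonomial l q : Fin k → Xi {l} k) := by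
  refine Fintype.linearIndependent_iff.2 fun c hc j => ?_
  have := congrFun (congrFun hc ⟨l, Finset.mem_singleton_self l⟩) j
  simpa [xiMonomial, Finset.sum_apply, Pi.single_apply] using this

/-- The linear form `φ ↦ ± φ_j` on `Ξ_l`; the order and the signs make these forms a Jordan
chain. -/
def xiCoord (l : ℚ) (j : Fin k) : ABDual (Xi {l} k) :=
  (-1 : ℂ⟦X⟧) ^ (j : ℕ) •
    (LinearMap.proj j.rev ∘ₗ LinearMap.proj ⟨l, Finset.mem_singleton_self l⟩ :
      Xi {l} k →ₗ[ℂ⟦X⟧] ℂ⟦X⟧)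

theorem xiCoord_apply (j : Fin k) (φ : Xi {l} k) : (xiCoord l j φ).series =
    (-1) ^ (j : ℕ) * φ ⟨l, Finset.mem_singleton_self l⟩ j.rev := rfl

theorem isJordanChain_xiCoord (l : ℚ) (k : ℕ) :
    IsJordanChain (-(l : ℂ)) (xiCoord l : Fin k → ABDual (Xi {l} k)) := fun j => by
  refine LinearMap.ext fun φ => ?_
  have bbD_sign (S : ℂ⟦X⟧) : bbD ((-1) ^ (j : ℕ) * S) = (-1) ^ (j : ℕ) * bbD S := by
    rcases neg_one_pow_eq_or ℂ⟦X⟧ (j : ℕ) with h | h <;> simp [h, bbD]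
  have sign (i : ℕ) : ((-1) ^ (i + j) * (-1) ^ i : ℂ⟦X⟧) = (-1) ^ (j : ℕ) := by
    rw [← pow_add, show i + j + i = j + 2 * i by ring, pow_add, pow_mul, neg_one_sq, one_pow,
      mul_one]
  rw [LinearMap.sum_apply]
  change rankOneA 0 (xiCoord l j φ).series - (xiCoord l j (opA φ)).series =
    ∑ i, PowerSeries.C (jordanBlock (-(l : ℂ)) k i j) * PowerSeries.X * (xiCoord l i φ).series
  simp only [xiCoord_apply, opA_apply, ← neg_jordanBlock_rev, rankOneA, bbD_sign]
  rw [← Equiv.sum_comp Fin.revPerm]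
  simp only [Fin.revPerm_apply, Rat.cast_zero, map_zero, zero_mul, add_zero, mul_add,
    sub_add_cancel_left, Finset.mul_sum, ← Finset.sum_neg_distrib, map_neg, map_mul, map_pow,
    map_one]
  refine Finset.sum_congr rfl fun i _ => ?_
  rw [← sign i]
  ring

theorem linearIndependent_xiCoord (l : ℚ) (k : ℕ) :
    LinearIndependent ℂ⟦X⟧ (xiCoord l : Fin k → ABDual (Xi {l} k)) := by
  refine Fintype.linearIndependent_iff.2 fun c hc j => ?_
  have hcj : ∑ i, c i * (xiCoord l i (xiMonomial l 0 j.rev)).series = 0 := by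
    have := LinearMap.congr_fun hc (xiMonomial l 0 j.rev)
    rwa [LinearMap.sum_apply] at this
  simpa [xiCoord_apply, xiMonomial, Pi.single_apply, Fin.rev_inj] using hcj

variable {E : Type u} [AddCommGroup E] [Module ℂ⟦X⟧ E]

theorem linearIndependent_xiCoord_comp (e : Module.Basis (Fin k) ℂ⟦X⟧ E)
    {f : E →ₗ[ℂ⟦X⟧] Xi {l} k} (hf : Function.Injective f) :
    LinearIndependent ℂ⟦X⟧ fun j => xiCoord l j ∘ₗ f := by
  have : Module.IsTorsionFree ℂ⟦X⟧ (RankOne 0) :=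
    inferInstanceAs (Module.IsTorsionFree ℂ⟦X⟧ ℂ⟦X⟧)
  exact (linearIndependent_xiCoord l k).map' (LinearMap.lcomp ℂ⟦X⟧ (RankOne 0) f)
    (LinearMap.ker_eq_bot.2 (lcomp_injective e
      ((Pi.basisFun ℂ⟦X⟧ (Fin k)).map (LinearEquiv.funUnique _ _ _).symm) hf))

end Xi

section Restriction

/-- The component of exponent `μ` of an asymptotic expansion (zero if `μ ∉ Λ`). -/
def xiComponent (Λ : Finset ℚ) (n : ℕ) (μ : ℚ) : Xi Λ n →ₗ[ℂ⟦X⟧] Xi {μ} n :=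
  LinearMap.pi fun _ => if h : μ ∈ Λ then LinearMap.proj ⟨μ, h⟩ else 0

theorem xiComponent_apply {Λ : Finset ℚ} {n : ℕ} {μ : ℚ} (h : μ ∈ Λ) (φ : Xi Λ n) (ν) :
    xiComponent Λ n μ φ ν = φ ⟨μ, h⟩ := by
  simp [xiComponent, h]

theorem commutesWithA_xiComponent (Λ : Finset ℚ) (n : ℕ) (μ : ℚ) :
    CommutesWithA (xiComponent Λ n μ) := fun φ => by
  funext ⟨ν, hν⟩ i
  obtain rfl := Finset.mem_singleton.1 hν
  by_cases h : ν ∈ Λ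
  · rw [opA_apply, xiComponent_apply h, xiComponent_apply h, opA_apply]
  · simp [xiComponent, h, opA_apply, bbD]

end Restriction

section Primitive

variable {E : Type u} [AddCommGroup E] [Module ℂ⟦X⟧ E] [ABModule E]

theorem IsJordanChain.eq_zero {Λ : Finset ℚ} {n k : ℕ} {ρ : ℂ} {u : Fin k → Xi Λ n}
    (hu : IsJordanChain ρ u) (hρ : ∀ μ ∈ Λ, ∀ m : ℕ, (m : ℂ) + (μ : ℂ) ≠ ρ) (j : Fin k) :
    u j = 0 := by
  funext μ i
  ext m
  by_contra h
  exact hρ μ μ.2 m (hu.exponent_eq h)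

theorem IsJordanChain.exists_exponent_eq {k : ℕ} {ρ : ℂ} {u : Fin k → E} (hu : IsJordanChain ρ u)
    (hE : IsTheme E) {j : Fin k} (hj : u j ≠ 0) :
    ∃ (q : ℕ) (l : ℚ), (0 < l ∧ l ≤ 1) ∧ (q : ℂ) + (l : ℂ) = ρ := by
  obtain ⟨Λ, n, φ, hΛ, θ, hθ, hθa, -⟩ := hE
  by_contra! h
  exact hj ((map_eq_zero_iff θ hθ).1
    ((hu.map hθa).eq_zero (fun μ hμ m => h m μ (hΛ μ hμ)) j))

theorem opA_sub_smul_eq_zero_of_le {Λ : Finset ℚ} {n m : ℕ} {φ : Xi Λ n} {μ : Λ} {j : Fin n}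
    (hj : φ μ j = PowerSeries.X ^ m) (habove : ∀ i, j < i → φ μ i = 0) {i : Fin n} (hi : j ≤ i) :
    (opA φ - (PowerSeries.C ((m : ℂ) + ((μ : ℚ) : ℂ)) * PowerSeries.X) • φ) μ i = 0 := by
  rw [Pi.sub_apply, Pi.sub_apply, Pi.smul_apply, Pi.smul_apply, smul_eq_mul]
  change bbD (φ μ i) + _ * φ μ i + (if h : (i : ℕ) + 1 < n then _ * φ μ ⟨i + 1, h⟩ else 0) -
    _ * φ μ i = 0
  have next : (if h : (i : ℕ) + 1 < n then PowerSeries.X * φ μ ⟨i + 1, h⟩ else 0) = 0 := by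
    split_ifs with h
    · rw [habove _ (Fin.lt_def.2 (Nat.lt_succ_of_le hi)), mul_zero]
    · rfl
  rw [next]
  rcases hi.eq_or_lt with rfl | hlt
  · rw [hj, bbD_X_pow, map_add]
    ring
  · rw [habove i hlt, bbD_zero]
    ring

/-- By induction on the number of logarithms: if `θ x = b^m e_{l,j} + ⋯` then `a x - (m + l) b x`
has fewer logarithms, so `a g x = (m + l) b g x`. -/
theorem eq_zero_of_disjoint_exponents {l : ℚ} {n : ℕ} {θ : E →ₗ[ℂ⟦X⟧] Xi {l} n}
    (hθ : Function.Injective θ) (hθa : CommutesWithA θ) {Λ : Finset ℚ} {p : ℕ}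
    {g : E →ₗ[ℂ⟦X⟧] Xi Λ p} (hg : CommutesWithA g)
    (hΛ : ∀ μ ∈ Λ, ∀ m m' : ℕ, (m' : ℚ) + μ ≠ m + l) : g = 0 := by
  suffices vanish : ∀ j x, (∀ μ (i : Fin n), j ≤ (i : ℕ) → θ x μ i = 0) → g x = 0 from
    LinearMap.ext fun x => vanish n x fun μ i hi => absurd i.2 (not_lt.2 hi)
  intro j
  induction j with
  | zero =>
    intro x hx
    have : x = 0 := hθ (by rw [map_zero]; exact funext fun μ => funext fun i => hx μ i i.1.zero_le)
    rw [this, map_zero]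
  | succ j ih =>
    intro x hx
    by_cases hj : ∀ μ (i : Fin n), i = j → θ x μ i = 0
    · exact ih x fun μ i hi => hi.eq_or_lt.elim (fun h => hj μ i h.symm) (hx μ i)
    push Not at hj
    obtain ⟨⟨μ, hμ⟩, j, rfl, hne⟩ := hj
    obtain rfl := Finset.mem_singleton.1 hμ
    obtain ⟨m, w, hw⟩ := IsDiscreteValuationRing.eq_unit_mul_pow_irreducible hne
      PowerSeries.X_irreducible
    obtain ⟨y, rfl⟩ : ∃ y, x = (w : ℂ⟦X⟧) • y := ⟨w⁻¹ • x, (smul_inv_smul w x).symm⟩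
    simp only [map_smul, Pi.smul_apply, smul_eq_mul, w.mul_right_inj, w.mul_right_eq_zero] at hw hx
    have gy : g (opA y - (PowerSeries.C ((m : ℂ) + (μ : ℂ)) * PowerSeries.X) • y) = 0 := by
      refine ih _ fun ⟨ν, hν⟩ i hi => ?_
      obtain rfl := Finset.mem_singleton.1 hν
      rw [map_sub, map_smul, hθa]
      exact opA_sub_smul_eq_zero_of_le hw (fun i hi => hx _ i hi) hi
    have chain : IsJordanChain ((m : ℂ) + (μ : ℂ)) fun _ : Fin 1 => g y := fun _ => by
      rw [map_sub, map_smul, sub_eq_zero, hg] at gy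
      rwa [Fin.sum_univ_one, jordanBlock, Matrix.of_apply, if_pos (Subsingleton.elim _ _)]
    rw [map_smul, chain.eq_zero (fun ν hν m' => by exact_mod_cast hΛ ν hν m m') 0, smul_zero]

theorem natCast_add_inj {m m' : ℕ} {l l' : ℚ} (hl : 0 < l ∧ l ≤ 1) (hl' : 0 < l' ∧ l' ≤ 1)
    (h : (m : ℚ) + l = m' + l') : m = m' ∧ l = l' := by
  have hm : m = m' := by
    have hlt : (m : ℚ) < m' + 1 := by linarith
    have hgt : (m' : ℚ) < m + 1 := by linarith
    norm_cast at hlt hgt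
    omega
  subst hm
  exact ⟨rfl, add_left_cancel h⟩

theorem IsPrimitiveTheme.injective_xiComponent_comp {l : ℚ} (hl : 0 < l ∧ l ≤ 1)
    (hE : IsPrimitiveTheme l E) {Λ : Finset ℚ} (hΛ : ∀ μ ∈ Λ, 0 < μ ∧ μ ≤ 1) {p : ℕ}
    {ι : E →ₗ[ℂ⟦X⟧] Xi Λ p} (hι : Function.Injective ι) (hιa : CommutesWithA ι) :
    Function.Injective (xiComponent Λ p l ∘ₗ ι) := by
  obtain ⟨n, φ, θ, hθ, hθa, -⟩ := hE
  have other (μ : ℚ) (hμ : μ ∈ Λ) (hne : μ ≠ l) : xiComponent Λ p μ ∘ₗ ι = 0 := by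
    refine eq_zero_of_disjoint_exponents hθ hθa
      ((commutesWithA_xiComponent Λ p μ).comp hιa)
      fun ν hν m m' h => hne ?_
    obtain rfl := Finset.mem_singleton.1 hν
    exact (natCast_add_inj (hΛ _ hμ) hl h).2
  refine (injective_iff_map_eq_zero _).2 fun x hx => hι ?_
  rw [map_zero]
  funext ⟨μ, hμ⟩
  rw [← xiComponent_apply hμ (ι x) ⟨μ, Finset.mem_singleton_self μ⟩]
  by_cases hne : μ = l
  · subst hne
    exact congrFun hx ⟨μ, Finset.mem_singleton_self μ⟩
  · exact congrFun (LinearMap.congr_fun (other μ hμ hne) x) ⟨μ, Finset.mem_singleton_self μ⟩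

end Primitive

section Basis

variable {K A : Type*} [Field K] [CommRing A] [Algebra K A]

theorem exists_linearMap_algebraMap_eq_single {ι : Type*} [Finite ι] {k : ℕ} {c : Fin k → ι → K}
    (hc : LinearIndependent K c) : ∃ f : (ι → A) →ₗ[A] (Fin k → A),
      ∀ j, f (algebraMap K A ∘ c j) = Pi.single j 1 := by
  classical
  have := Fintype.ofFinite ι
  obtain ⟨g, hg⟩ := (Fintype.linearCombination K c).exists_leftInverse_of_injective
    (LinearMap.ker_eq_bot.2 hc.fintypeLinearCombination_injective)
  refine ⟨((LinearMap.toMatrix' g).map (algebraMap K A)).mulVecLin, fun j => ?_⟩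
  have hgc : g (c j) = Pi.single j 1 := by
    simpa using LinearMap.congr_fun hg (Pi.single j 1)
  funext i
  rw [Matrix.mulVecLin_apply, ← RingHom.map_mulVec, LinearMap.toMatrix'_mulVec, hgc]
  simp [Pi.single_apply, apply_ite (algebraMap K A)]

theorem linearIndependent_of_map_eq_smul_algebraMap [Nontrivial A] {ι κ M : Type*} [Finite κ]
    [AddCommGroup M] [Module A M] {f : M →ₗ[A] ι → A} (hf : Function.Injective f) {u : κ → M}
    (hu : LinearIndependent A u) {r : A} {c : κ → ι → K}
    (h : ∀ j, f (u j) = r • (algebraMap K A ∘ c j)) : LinearIndependent K c := by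
  have := Fintype.ofFinite κ
  refine Fintype.linearIndependent_iff.2 fun a ha j => ?_
  have hsum : ∑ j, algebraMap K A (a j) • u j = 0 := by
    apply hf
    simp only [map_sum, map_smul, h, map_zero]
    funext p
    have hap := congrArg (algebraMap K A) (congrFun ha p)
    simp only [Finset.sum_apply, Pi.smul_apply, smul_eq_mul, map_sum, map_mul, Pi.zero_apply,
      map_zero, Function.comp_apply] at hap ⊢
    rw [← mul_zero r, ← hap, Finset.mul_sum]
    exact Finset.sum_congr rfl fun j _ => mul_left_comm _ _ _
  exact (map_eq_zero_iff _ (algebraMap K A).injective).1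
    (Fintype.linearIndependent_iff.1 hu _ hsum j)

end Basis

section ChainEmbedding

variable {Λ : Finset ℚ} {n k q : ℕ} {l : ℚ}

theorem IsJordanChain.eq_X_pow_smul {u : Fin k → Xi Λ n}
    (hu : IsJordanChain ((q : ℂ) + (l : ℂ)) u) (hl : 0 < l ∧ l ≤ 1)
    (hΛ : ∀ μ ∈ Λ, 0 < μ ∧ μ ≤ 1) (j : Fin k) :
    u j = (PowerSeries.X ^ q : ℂ⟦X⟧) •
      fun μ i => algebraMap ℂ ℂ⟦X⟧ (PowerSeries.coeff q (u j μ i)) := by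
  funext μ i
  ext m
  rw [Pi.smul_apply, Pi.smul_apply, smul_eq_mul, mul_comm, PowerSeries.algebraMap_apply,
    Algebra.algebraMap_self_apply, PowerSeries.coeff_C_mul, PowerSeries.coeff_X_pow, mul_ite,
    mul_one, mul_zero]
  split_ifs with h
  · rw [h]
  · by_contra hne
    exact h (natCast_add_inj (hΛ μ μ.2) hl (by exact_mod_cast hu.exponent_eq hne)).1

variable {F : Type v} [AddCommGroup F] [Module ℂ⟦X⟧ F] [ABModule F]

theorem exists_embedding_of_isJordanChain (e : Module.Basis (Fin k) ℂ⟦X⟧ F)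
    {θ : F →ₗ[ℂ⟦X⟧] Xi Λ n} (hθ : Function.Injective θ) (hθa : CommutesWithA θ)
    (hΛ : ∀ μ ∈ Λ, 0 < μ ∧ μ ≤ 1) (hl : 0 < l ∧ l ≤ 1) {u : Fin k → F}
    (hu : IsJordanChain ((q : ℂ) + (l : ℂ)) u) (hu' : LinearIndependent ℂ⟦X⟧ u) :
    ∃ κ : F →ₗ[ℂ⟦X⟧] Xi {l} k, Function.Injective κ ∧ CommutesWithA κ ∧
      ∀ j, κ (u j) = xiMonomial l q j := by
  let c (j : Fin k) (p : Λ × Fin n) : ℂ := PowerSeries.coeff q (θ (u j) p.1 p.2)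
  have hθu (j : Fin k) : (LinearEquiv.curry ℂ⟦X⟧ ℂ⟦X⟧ Λ (Fin n)).symm (θ (u j)) =
      (PowerSeries.X ^ q : ℂ⟦X⟧) • (algebraMap ℂ ℂ⟦X⟧ ∘ c j) := by
    funext p
    exact congrFun (congrFun ((hu.map hθa).eq_X_pow_smul hl hΛ j) p.1) p.2
  have hc : LinearIndependent ℂ c := linearIndependent_of_map_eq_smul_algebraMap
    (f := (LinearEquiv.curry ℂ⟦X⟧ ℂ⟦X⟧ Λ (Fin n)).symm.toLinearMap ∘ₗ θ)
    ((LinearEquiv.curry ℂ⟦X⟧ ℂ⟦X⟧ Λ (Fin n)).symm.injective.comp hθ) hu' hθu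
  obtain ⟨f, hf⟩ := exists_linearMap_algebraMap_eq_single (A := ℂ⟦X⟧) hc
  let κ : F →ₗ[ℂ⟦X⟧] Xi {l} k :=
    LinearMap.pi (fun _ => f) ∘ₗ (LinearEquiv.curry ℂ⟦X⟧ ℂ⟦X⟧ Λ (Fin n)).symm.toLinearMap ∘ₗ θ
  have hκ (j : Fin k) : κ (u j) = xiMonomial l q j := by
    funext μ i
    change f ((LinearEquiv.curry ℂ⟦X⟧ ℂ⟦X⟧ Λ (Fin n)).symm (θ (u j))) i = _
    rw [hθu, map_smul, hf]
    simp [xiMonomial, Pi.single_apply]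
  have hκu : κ ∘ u = xiMonomial l q := funext hκ
  refine ⟨κ, injective_of_linearIndependent_comp e (u := u) ?_,
    hu.commutesWithA e hu' ?_, hκ⟩
  · rw [hκu]
    exact linearIndependent_xiMonomial l q k
  · rw [hκu]
    exact isJordanChain_xiMonomial l q k

end ChainEmbedding

section CyclicVector

variable {E : Type u} [AddCommGroup E] [Module ℂ⟦X⟧ E] [ABModule E]

theorem IsGeneratedBy.exists_span_eq_top {Λ : Finset ℚ} {n : ℕ} {φ : Xi Λ n}
    (h : IsGeneratedBy E φ) :
    ∃ f : E, Submodule.span ℂ⟦X⟧ (Set.range fun ν : ℕ => opA^[ν] f) = ⊤ := by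
  obtain ⟨ι, hι, hιa, hrange⟩ := h
  obtain ⟨f, rfl⟩ : φ ∈ LinearMap.range ι := hrange ▸ Submodule.subset_span ⟨0, rfl⟩
  refine ⟨f, Submodule.map_injective_of_injective hι ?_⟩
  rw [Submodule.map_top, hrange, Submodule.map_span, ← Set.range_comp]
  congr 2
  exact funext fun ν => Function.Semiconj.iterate_right hιa ν f

theorem exists_linear_iterate_opA_sub_mem {k : ℕ} (e : Module.Basis (Fin k) ℂ⟦X⟧ E) :
    ∃ A : Module.End ℂ⟦X⟧ E, ∀ (ν : ℕ) (f : E),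
      opA^[ν] f - (A ^ ν) f ∈ IsLocalRing.maximalIdeal ℂ⟦X⟧ • (⊤ : Submodule ℂ⟦X⟧ E) := by
  let A : Module.End ℂ⟦X⟧ E := e.constr ℂ⟦X⟧ fun i => opA (e i)
  have opA_sub_mem (x : E) :
      opA x - A x ∈ IsLocalRing.maximalIdeal ℂ⟦X⟧ • (⊤ : Submodule ℂ⟦X⟧ E) := by
    have hx : opA x - A x = ∑ i, bbD (e.repr x i) • e i := by
      nth_rewrite 1 2 [← e.sum_repr x]
      simp only [map_sum, ABModule.a_smul, map_smul, A, e.constr_basis, Finset.sum_add_distrib,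
        add_sub_cancel_left]
    rw [hx, PowerSeries.maximalIdeal_eq_span_X]
    exact Submodule.sum_mem _ fun i _ => Submodule.smul_mem_smul
      (Ideal.mem_span_singleton.2 (X_dvd_bbD _)) Submodule.mem_top
  refine ⟨A, fun ν f => ?_⟩
  induction ν with
  | zero => simp
  | succ ν ih =>
    rw [Function.iterate_succ_apply', pow_succ', Module.End.mul_apply,
      ← sub_add_sub_cancel _ (A (opA^[ν] f)), ← map_sub A]
    refine Submodule.add_mem _ (opA_sub_mem _)
      (smul_mono_right (IsLocalRing.maximalIdeal ℂ⟦X⟧) (le_top (a := Submodule.map A ⊤)) ?_)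
    rw [← Submodule.map_smul'']
    exact Submodule.mem_map_of_mem ih

/-- Modulo `b` the operator `a` is linear, so Cayley–Hamilton applies to it. -/
theorem span_iterate_opA_lt_eq_top {k : ℕ} (e : Module.Basis (Fin k) ℂ⟦X⟧ E) {f : E}
    (hf : Submodule.span ℂ⟦X⟧ (Set.range fun ν : ℕ => opA^[ν] f) = ⊤) :
    Submodule.span ℂ⟦X⟧ (Set.range fun j : Fin k => opA^[(j : ℕ)] f) = ⊤ := by
  obtain ⟨A, hA⟩ := exists_linear_iterate_opA_sub_mem e
  have : Module.Finite ℂ⟦X⟧ E := .of_basis e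
  have : Module.Free ℂ⟦X⟧ E := .of_basis e
  refine top_le_iff.1 (Submodule.le_of_le_smul_of_le_jacobson_bot Module.Finite.fg_top
    (IsLocalRing.maximalIdeal_le_jacobson ⊥) ?_)
  rw [← hf, Submodule.span_le, hf, Set.range_subset_iff]
  intro ν
  rw [SetLike.mem_coe, ← sub_add_cancel (opA^[ν] f) ((A ^ ν) f)]
  refine Submodule.add_mem _ (Submodule.mem_sup_right (hA ν f))
    (Submodule.span_le.2 (Set.range_subset_iff.2 fun j => ?_) (pow_apply_mem_span_iterates A ν f))
  rw [SetLike.mem_coe, ← sub_sub_cancel (opA^[(j : ℕ)] f) ((A ^ (j : ℕ)) f)]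
  refine Submodule.sub_mem _ (Submodule.mem_sup_left (Submodule.subset_span ?_))
    (Submodule.mem_sup_right (hA j f))
  exact ⟨finCongr (by rw [Module.finrank_eq_card_basis e, Fintype.card_fin]) j, rfl⟩

theorem isUnit_det_iterate_opA {k : ℕ} (e : Module.Basis (Fin k) ℂ⟦X⟧ E) {f : E}
    (hf : Submodule.span ℂ⟦X⟧ (Set.range fun ν : ℕ => opA^[ν] f) = ⊤) :
    IsUnit (e.det fun j : Fin k => opA^[(j : ℕ)] f) := by
  have hspan := span_iterate_opA_lt_eq_top e hf
  exact e.is_basis_iff_det.1 ⟨linearIndependent_of_top_le_span_of_card_eq_finrank hspan.ge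
    (Module.finrank_eq_card_basis e).symm, hspan⟩

end CyclicVector

section Order

theorem coeff_one_eq_order {d T : ℂ⟦X⟧} (h : bbD d = T * d) {m : ℕ} (hm : d.order = m) :
    PowerSeries.coeff 1 T = m := by
  obtain ⟨hne, hlow⟩ := PowerSeries.order_eq_nat.1 hm
  obtain ⟨u, rfl⟩ := PowerSeries.X_pow_dvd_iff.2 hlow
  have hu : PowerSeries.constantCoeff u ≠ 0 := by
    simpa [PowerSeries.coeff_X_pow_mul'] using hne
  have hbbD : bbD u + PowerSeries.C (m : ℂ) * PowerSeries.X * u = T * u := by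
    apply mul_left_cancel₀ (pow_ne_zero m PowerSeries.X_ne_zero)
    rw [bbD_mul, bbD_X_pow] at h
    linear_combination h
  have hT : PowerSeries.constantCoeff T = 0 := by
    have := congrArg PowerSeries.constantCoeff hbbD
    simp only [bbD, map_add, map_mul, map_pow, PowerSeries.constantCoeff_X, mul_zero, zero_mul,
      add_zero, zero_pow two_ne_zero] at this
    exact (mul_eq_zero.1 this.symm).resolve_right hu
  have hcoeff := congrArg (PowerSeries.coeff 1) hbbD
  rw [map_add, coeff_succ_bbD, PowerSeries.coeff_one_mul T, hT, mul_assoc,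
    PowerSeries.coeff_C_mul, PowerSeries.coeff_succ_X_mul] at hcoeff
  simp only [Nat.cast_zero, zero_mul, zero_add, mul_zero, add_zero,
    PowerSeries.coeff_zero_eq_constantCoeff] at hcoeff
  exact (mul_right_cancel₀ hu hcoeff).symm

variable {E : Type u} [AddCommGroup E] [Module ℂ⟦X⟧ E] [ABModule E]

theorem bbD_det_toMatrix {k : ℕ} (f : Module.Basis (Fin k) ℂ⟦X⟧ E) {u : Fin k → E}
    {M : Matrix (Fin k) (Fin k) ℂ⟦X⟧} (hu : ∀ j, opA (u j) = ∑ i, M i j • u i) :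
    bbD (f.toMatrix u).det =
      (M.trace - (f.toMatrix (opA ∘ f)).trace) * (f.toMatrix u).det := by
  set P := f.toMatrix u
  set B := f.toMatrix (opA ∘ f)
  have hPM : P.map bbDerivation = P * M - B * P := by
    ext1 i j
    have hopA : opA (u j) = ∑ p, (P p j • opA (f p) + bbD (P p j) • f p) := by
      nth_rewrite 1 [← f.sum_repr (u j)]
      simp only [map_sum, ABModule.a_smul]
      rfl
    have := congrArg (fun x => f.repr x i) ((hu j).symm.trans hopA)
    simp only [map_sum, map_add, map_smul, Finsupp.coe_finsetSum, Finset.sum_apply,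
      Finsupp.add_apply, Finsupp.smul_apply, smul_eq_mul, f.repr_self, Finset.sum_add_distrib,
      Finsupp.single_apply, mul_ite, mul_one, mul_zero, Finset.sum_ite_eq', Finset.mem_univ,
      if_true] at this
    simp only [Matrix.map_apply, bbDerivation_apply, Matrix.sub_apply, Matrix.mul_apply]
    calc bbD (P i j) = ∑ c, M c j * P i c - ∑ c, P c j * B i c :=
          eq_sub_iff_add_eq'.2 this.symm
      _ = _ := by simp only [mul_comm]
  rw [← bbDerivation_apply, derivation_det, hPM, Matrix.mul_sub, Matrix.trace_sub,
    ← Matrix.mul_assoc, Matrix.adjugate_mul, Matrix.trace_mul_comm _ (B * P), Matrix.mul_assoc,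
    Matrix.mul_adjugate]
  simp only [Algebra.smul_mul_assoc, one_mul, Matrix.trace_smul, smul_eq_mul,
    Algebra.mul_smul_comm, mul_one]
  ring

end Order

section Holomorphic

theorem exists_opens_of_eventually {X : TopCat.{u}} {U : Opens X} {x : U} {p : U → Prop}
    (h : ∀ᶠ y in nhds x, p y) :
    ∃ (V : Opens X) (hV : V ≤ U), x.1 ∈ V ∧ ∀ y : V, p ⟨y, hV y.2⟩ := by
  obtain ⟨W, hWp, hW, hxW⟩ := eventually_nhds_iff.1 h
  refine ⟨⟨Subtype.val '' W, U.2.isOpenMap_subtype_val W hW⟩, ?_, ⟨x, hxW, rfl⟩, ?_⟩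
  · rintro _ ⟨y, -, rfl⟩
    exact y.2
  · rintro ⟨_, y, hy, rfl⟩
    exact hWp y hy

variable {X : TopCat.{u}} [ReducedComplexSpace X] {U : Opens X}

theorem IsHol.continuous {f : U → ℂ} (hf : IsHol f) : Continuous f := by
  rw [continuous_iff_continuousAt]
  intro x
  obtain ⟨W, n, m, Z, g, z, hxW, -, -, hz, -, hchart⟩ := ReducedComplexSpace.chart x.1
  have hlocal := (hchart (U ⊓ W) inf_le_right fun y => f ⟨y, y.2.1⟩).1
    (ReducedComplexSpace.hol.res (inf_le_left (b := W)).hom _ hf)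
  obtain ⟨N, G, hN, hxN, hG, hfG⟩ := hlocal ⟨x, x.2, hxW⟩
  have hc : ContinuousAt (fun y : (U ⊓ W : Opens X) => f ⟨y, y.2.1⟩) ⟨x, x.2, hxW⟩ := by
    have hzc : Continuous fun y : (U ⊓ W : Opens X) => z ⟨y, y.2.2⟩ :=
      hz.continuous.comp (continuous_subtype_val.subtype_mk _)
    have hGz : ContinuousAt (fun y : (U ⊓ W : Opens X) => G (z ⟨y, y.2.2⟩)) ⟨x, x.2, hxW⟩ :=
      ContinuousAt.comp (f := fun y : (U ⊓ W : Opens X) => z ⟨y, y.2.2⟩)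
        ((hG.differentiableAt (hN.mem_nhds hxN)).continuousAt) hzc.continuousAt
    refine hGz.congr ?_
    filter_upwards [hzc.continuousAt.preimage_mem_nhds (hN.mem_nhds hxN)] with y hy
    exact (hfG y hy).symm
  have ho : Topology.IsOpenEmbedding
      (fun y : (U ⊓ W : Opens X) => (⟨y, y.2.1⟩ : U)) :=
    Opens.isOpenEmbedding_of_le inf_le_left
  exact (ho.continuousAt_iff (x := ⟨x, x.2, hxW⟩) (g := f)).1 hc

theorem IsHol.inv {f : U → ℂ} (hf : IsHol f) (h0 : ∀ x, f x ≠ 0) :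
    IsHol fun x => (f x)⁻¹ := by
  apply ReducedComplexSpace.hol.locality
  intro x
  obtain ⟨W, n, m, Z, g, z, hxW, -, -, -, -, hchart⟩ := ReducedComplexSpace.chart x.1
  refine ⟨U ⊓ W, ⟨x.2, hxW⟩, (inf_le_left (b := W)).hom, ?_⟩
  refine (hchart (U ⊓ W) inf_le_right _).2 fun y => ?_
  have hlocal := (hchart (U ⊓ W) inf_le_right fun y => f ⟨y, y.2.1⟩).1
    (ReducedComplexSpace.hol.res (inf_le_left (b := W)).hom _ hf)
  obtain ⟨N, G, hN, hyN, hG, hfG⟩ := hlocal y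
  refine ⟨N ∩ G ⁻¹' {0}ᶜ, fun w => (G w)⁻¹,
    hG.continuousOn.isOpen_inter_preimage hN isOpen_compl_singleton, ⟨hyN, ?_⟩,
    (hG.mono Set.inter_subset_left).inv fun w hw => hw.2, fun y' hy' => ?_⟩
  · have := h0 ⟨y, y.2.1⟩
    rw [hfG y hyN] at this
    exact this
  · exact congrArg _ (hfG y' hy'.1)

theorem IsHolSeries.neg {F : U → ℂ⟦X⟧} (hF : IsHolSeries F) :
    IsHolSeries fun x => -F x := by
  simpa using (IsHolSeries.const U (-1)).mul hF

theorem IsHolSeries.sub {F G : U → ℂ⟦X⟧} (hF : IsHolSeries F)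
    (hG : IsHolSeries G) : IsHolSeries fun x => F x - G x := by
  simpa [sub_eq_add_neg] using hF.add hG.neg

theorem IsHolSeries.finset_prod {ι : Type*} (s : Finset ι) {F : ι → U → ℂ⟦X⟧}
    (h : ∀ i ∈ s, IsHolSeries (F i)) : IsHolSeries fun x => ∏ i ∈ s, F i x := by
  classical
  induction s using Finset.induction_on with
  | empty => simpa using IsHolSeries.const U 1
  | insert i s hi ih =>
    simp only [Finset.prod_insert hi]
    exact (h i (by simp)).mul (ih fun j hj => h j (by simp [hj]))

theorem IsHolSeries.inv {F : U → ℂ⟦X⟧} (hF : IsHolSeries F)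
    (h0 : ∀ x, PowerSeries.coeff 0 (F x) ≠ 0) : IsHolSeries fun x => (F x)⁻¹ := by
  intro n
  induction n using Nat.strong_induction_on with
  | _ n ih =>
    have hinv := (hF 0).inv h0
    rcases Nat.eq_zero_or_pos n with rfl | hn
    · simpa using hinv
    · have lower : IsHol fun x : U => ∑ p ∈ Finset.HasAntidiagonal.antidiagonal n,
          if p.2 < n then PowerSeries.coeff p.1 (F x) * PowerSeries.coeff p.2 (F x)⁻¹ else 0 := by
        refine IsHol.sum _ fun p _ => ?_
        split_ifs with hp
        · exact ReducedComplexSpace.mul_mem (hF _) (ih _ hp)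
        · exact ReducedComplexSpace.const_mem _ _
      have coeff_inv : (fun x => PowerSeries.coeff n (F x)⁻¹) = fun x : U =>
          -1 * (PowerSeries.coeff 0 (F x))⁻¹ * ∑ p ∈ Finset.HasAntidiagonal.antidiagonal n,
            if p.2 < n then PowerSeries.coeff p.1 (F x) * PowerSeries.coeff p.2 (F x)⁻¹ else 0 := by
        funext x
        rw [PowerSeries.coeff_inv, if_neg hn.ne', PowerSeries.coeff_zero_eq_constantCoeff_apply,
          neg_one_mul]
      exact coeff_inv ▸ ReducedComplexSpace.mul_mem
        (ReducedComplexSpace.mul_mem (ReducedComplexSpace.const_mem U (-1)) hinv) lower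

theorem IsHolSeries.det {k : ℕ} {M : U → Matrix (Fin k) (Fin k) ℂ⟦X⟧}
    (hM : ∀ i j, IsHolSeries fun x => M x i j) : IsHolSeries fun x => (M x).det := by
  simp only [Matrix.det_apply']
  exact IsHolSeries.sum _ fun σ _ => (IsHolSeries.const U _).mul
    (IsHolSeries.finset_prod _ fun i _ => hM _ _)

theorem IsHolSeries.adjugate {k : ℕ} {M : U → Matrix (Fin k) (Fin k) ℂ⟦X⟧}
    (hM : ∀ i j, IsHolSeries fun x => M x i j) (i j : Fin k) :
    IsHolSeries fun x => (M x).adjugate i j := by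
  simp only [Matrix.adjugate_apply]
  refine IsHolSeries.det fun p q => ?_
  by_cases h : p = j
  · subst h
    simpa using IsHolSeries.const U _
  · simpa [Matrix.updateRow_ne h] using hM p q

theorem IsHolSeries.of_X_pow_mul {F : U → ℂ⟦X⟧} (m : ℕ)
    (hF : IsHolSeries fun x => PowerSeries.X ^ m * F x) : IsHolSeries F := fun n => by
  simpa [PowerSeries.coeff_X_pow_mul] using hF (n + m)

theorem IsHolSeries.of_mul {F G H : U → ℂ⟦X⟧} (hF : IsHolSeries F) (hG : IsHolSeries G)
    {m : ℕ} (hm : ∀ x, (F x).order = m) (h : ∀ x, F x * H x = G x) : IsHolSeries H := by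
  choose u hu using fun x => PowerSeries.X_pow_dvd_iff.2 (PowerSeries.order_eq_nat.1 (hm x)).2
  have hu_hol : IsHolSeries u := IsHolSeries.of_X_pow_mul m (by simpa only [← hu] using hF)
  have hu_ne (x : U) : PowerSeries.coeff 0 (u x) ≠ 0 := by
    have hcoeff := (PowerSeries.order_eq_nat.1 (hm x)).1
    rw [hu] at hcoeff
    simpa [PowerSeries.coeff_X_pow_mul'] using hcoeff
  have hH (x : U) : PowerSeries.X ^ m * H x = (u x)⁻¹ * G x := by
    have hinv : (u x)⁻¹ * u x = 1 := PowerSeries.inv_mul_cancel _ (by simpa using hu_ne x)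
    rw [← h x, hu x]
    linear_combination (-PowerSeries.X ^ m * H x) * hinv
  exact IsHolSeries.of_X_pow_mul m (by simpa only [hH] using (hu_hol.inv hu_ne).mul hG)

theorem IsHolSeries.eventually_isUnit {F : U → ℂ⟦X⟧} (hF : IsHolSeries F) {x : U}
    (hx : IsUnit (F x)) : ∀ᶠ y in nhds x, IsUnit (F y) := by
  simp only [PowerSeries.isUnit_iff_constantCoeff, isUnit_iff_ne_zero,
    ← PowerSeries.coeff_zero_eq_constantCoeff_apply] at hx ⊢
  exact (hF 0).continuous.continuousAt.eventually_ne hx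

theorem isLocallyConstant_order {d T : U → ℂ⟦X⟧} (hT : IsHolSeries T) (hd : ∀ x, d x ≠ 0)
    (h : ∀ x, bbD (d x) = T x * d x) : IsLocallyConstant fun x => (d x).order := by
  have order_eq (x : U) : (d x).order = (d x).order.toNat :=
    (PowerSeries.coe_toNat_order (hd x)).symm
  have continuous_toNat : Continuous fun x => (d x).order.toNat := by
    refine (Complex.isUniformEmbedding_ofReal.isEmbedding.comp
      Nat.isClosedEmbedding_coe_real.isEmbedding).continuous_iff.2 ((hT 1).continuous.congr ?_)
    exact fun x => by simpa using coeff_one_eq_order (h x) (order_eq x)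
  rw [funext order_eq]
  exact ((IsLocallyConstant.iff_continuous _).2 continuous_toNat).comp (Nat.cast : ℕ → ℕ∞)

end Holomorphic

section Sheaf

variable {X : TopCat.{u}} [ReducedComplexSpace X] {U : Opens X}

section HolXi

variable {Λ : Finset ℚ} {n : ℕ}

theorem IsHolXi.opA {φ : U → Xi Λ n} (hφ : IsHolXi φ) : IsHolXi fun x => opA (φ x) := by
  intro l j
  simp only [opA_apply]
  exact (hφ l j).bbD.add ((IsHolSeries.const U _).mul
    (IsHolSeries.sum _ fun i _ => (IsHolSeries.const U _).mul (hφ l i)))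

theorem IsHolXi.iterate_opA {φ : U → Xi Λ n} (hφ : IsHolXi φ) (ν : ℕ) :
    IsHolXi fun x => Themes.opA^[ν] (φ x) := by
  induction ν with
  | zero => exact hφ
  | succ ν ih =>
    simp only [Function.iterate_succ_apply']
    exact ih.opA

theorem IsHolXi.sum_smul {ι : Type*} (s : Finset ι) {c : ι → U → ℂ⟦X⟧} {φ : ι → U → Xi Λ n}
    (hc : ∀ i ∈ s, IsHolSeries (c i)) (hφ : ∀ i ∈ s, IsHolXi (φ i)) :
    IsHolXi fun x => ∑ i ∈ s, c i x • φ i x := by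
  intro l j
  simp only [Finset.sum_apply, Pi.smul_apply, smul_eq_mul]
  exact IsHolSeries.sum s fun i hi => (hc i hi).mul (hφ i hi l j)

theorem IsHolXi.res {V : Opens X} (h : V ≤ U) {φ : U → Xi Λ n} (hφ : IsHolXi φ) :
    IsHolXi fun x : V => φ ⟨x, h x.2⟩ := fun l j => (hφ l j).res h

end HolXi

namespace ABSheaf

variable (𝔽 : ABSheaf.{u, v} X)

/-- The bases `e y` of the fibres form a frame of the sheaf on `U`. -/
def IsFrame {k : ℕ} (e : ∀ y : U, Module.Basis (Fin k) ℂ⟦X⟧ (𝔽.fiber y)) : Prop :=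
  ∀ (V : Opens X) (hV : V ≤ U) (s : ∀ y : V, 𝔽.fiber y), 𝔽.sec.pred s ↔
    ∃ c : Fin k → V → ℂ⟦X⟧, (∀ i, IsHolSeries (c i)) ∧
      ∀ y : V, s y = ∑ i, c i y • e ⟨y, hV y.2⟩ i

/-- A morphism, injective on each fibre, from `𝔽|_U` to the sheaf of holomorphic maps to `Ξ_Λ`,
given by its values on the fibres. -/
structure IsHolEmbedding {Λ : Finset ℚ} {n : ℕ}
    (ι : ∀ y : U, 𝔽.fiber y →ₗ[ℂ⟦X⟧] Xi Λ n) : Prop where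
  injective : ∀ y, Function.Injective (ι y)
  commutesWithA : ∀ y, CommutesWithA (ι y)
  isHolXi : ∀ {V : Opens X} (hV : V ≤ U) {s : ∀ y : V, 𝔽.fiber y}, 𝔽.sec.pred s →
    IsHolXi fun y : V => ι ⟨y, hV y.2⟩ (s y)

/-- The condition of `IsHolomorphicFamily` in a neighbourhood of `x`. -/
def IsThematicAt (k : ℕ) (x : X) : Prop :=
  ∃ (U : Opens X) (Λ : Finset ℚ) (φ : U → Xi Λ k) (ι : ∀ y : U, 𝔽.fiber y →ₗ[ℂ⟦X⟧] Xi Λ k),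
    x ∈ U ∧ (∀ l ∈ Λ, 0 < l ∧ l ≤ 1) ∧ IsThematic k φ ∧ (∀ y, Function.Injective (ι y)) ∧
    (∀ y, CommutesWithA (ι y)) ∧
    ∀ (V : Opens X) (hV : V ≤ U) (t : V → Xi Λ k), IsThematicSection k φ hV t ↔
      ∃ s : ∀ y : V, 𝔽.fiber y, 𝔽.sec.pred s ∧ ∀ y : V, ι ⟨y, hV y.2⟩ (s y) = t y

variable {𝔽} {k : ℕ} {e : ∀ y : U, Module.Basis (Fin k) ℂ⟦X⟧ (𝔽.fiber y)}

theorem iterate_opA_mem {s : ∀ y : U, 𝔽.fiber y} (hs : 𝔽.sec.pred s) (ν : ℕ) :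
    𝔽.sec.pred fun y => opA^[ν] (s y) := by
  induction ν with
  | zero => exact hs
  | succ ν ih =>
    simp only [Function.iterate_succ_apply']
    exact 𝔽.a_mem ih

theorem exists_isFrame {x : X} (b : Module.Basis (Fin k) ℂ⟦X⟧ (𝔽.fiber x)) :
    ∃ (U : Opens X) (e : ∀ y : U, Module.Basis (Fin k) ℂ⟦X⟧ (𝔽.fiber y)),
      x ∈ U ∧ 𝔽.IsFrame e := by
  obtain ⟨U, k', e, hx, he⟩ := 𝔽.locally_free x
  obtain rfl : k' = k := by simpa using Fintype.card_congr ((e ⟨x, hx⟩).indexEquiv b)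
  exact ⟨U, e, hx, he⟩

namespace IsFrame

theorem res (he : 𝔽.IsFrame e) {V : Opens X} (hV : V ≤ U) :
    𝔽.IsFrame fun y : V => e ⟨y, hV y.2⟩ := fun W hW s => he W (hW.trans hV) s

theorem isHolSeries_repr (he : 𝔽.IsFrame e) {s : ∀ y : U, 𝔽.fiber y} (hs : 𝔽.sec.pred s)
    (i : Fin k) : IsHolSeries fun y => (e y).repr (s y) i := by
  obtain ⟨c, hc, hsc⟩ := (he U le_rfl s).1 hs
  have repr_eq : (fun y => (e y).repr (s y) i) = c i := by
    funext y
    rw [hsc y]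
    simp [Finsupp.single_apply]
  exact repr_eq ▸ hc i

theorem sum_smul_mem (he : 𝔽.IsFrame e) {ι : Type*} [Fintype ι] {c : ι → U → ℂ⟦X⟧}
    (hc : ∀ j, IsHolSeries (c j)) {w : ι → ∀ y : U, 𝔽.fiber y} (hw : ∀ j, 𝔽.sec.pred (w j)) :
    𝔽.sec.pred fun y => ∑ j, c j y • w j y := by
  refine (he U le_rfl _).2 ⟨fun i y => ∑ j, c j y * (e y).repr (w j y) i, fun i =>
    IsHolSeries.sum _ fun j _ => (hc j).mul (he.isHolSeries_repr (hw j) i), fun y => ?_⟩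
  simp only [Finset.sum_smul, mul_smul]
  rw [Finset.sum_comm]
  exact Finset.sum_congr rfl fun j _ => by rw [← Finset.smul_sum, (e y).sum_repr]

theorem mem (he : 𝔽.IsFrame e) (i : Fin k) : 𝔽.sec.pred fun y => e y i :=
  (he U le_rfl _).2 ⟨fun j _ => if j = i then 1 else 0, fun _ => IsHolSeries.const U _,
    fun y => by simp⟩

theorem isHolSeries_det (he : 𝔽.IsFrame e) {w : Fin k → ∀ y : U, 𝔽.fiber y}
    (hw : ∀ j, 𝔽.sec.pred (w j)) : IsHolSeries fun y => ((e y).toMatrix (w · y)).det :=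
  IsHolSeries.det fun i j => he.isHolSeries_repr (hw j) i

theorem isHolSeries_adjugate_mulVec (he : 𝔽.IsFrame e) {w : Fin k → ∀ y : U, 𝔽.fiber y}
    (hw : ∀ j, 𝔽.sec.pred (w j)) {s : ∀ y : U, 𝔽.fiber y} (hs : 𝔽.sec.pred s) (j : Fin k) :
    IsHolSeries fun y => (((e y).toMatrix (w · y)).adjugate *ᵥ (e y).repr (s y)) j := by
  simp only [Matrix.mulVec, dotProduct]
  refine IsHolSeries.sum _ fun i _ => .mul ?_ (he.isHolSeries_repr hs i)
  exact IsHolSeries.adjugate (fun p q => he.isHolSeries_repr (hw q) p) j i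

theorem of_mem (he : 𝔽.IsFrame e) {e' : ∀ y : U, Module.Basis (Fin k) ℂ⟦X⟧ (𝔽.fiber y)}
    (he' : ∀ j, 𝔽.sec.pred fun y => e' y j) : 𝔽.IsFrame e' := by
  intro V hV s
  have he'V (j : Fin k) : 𝔽.sec.pred fun y : V => e' ⟨y, hV y.2⟩ j :=
    𝔽.sec.res hV.hom _ (he' j)
  refine ⟨fun hs => ⟨fun j y => (e' ⟨y, hV y.2⟩).repr (s y) j, fun j => ?_,
    fun y => ((e' ⟨y, hV y.2⟩).sum_repr _).symm⟩, ?_⟩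
  · refine IsHolSeries.of_mul (m := 0) ((he.res hV).isHolSeries_det he'V)
      ((he.res hV).isHolSeries_adjugate_mulVec he'V hs j) (fun y => ?_)
      fun y => det_toMatrix_mul_repr _ _ _ j
    exact PowerSeries.order_zero_of_unit (Module.Basis.isUnit_det _ _)
  · rintro ⟨c, hc, hs⟩
    rw [funext hs]
    exact (he.res hV).sum_smul_mem hc he'V

end IsFrame

end ABSheaf

end Sheaf

section Embedding

variable {X : TopCat.{u}} [ReducedComplexSpace X] {U : Opens X}

namespace ABSheaf

variable {𝔽 : ABSheaf.{u, v} X} {k : ℕ}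
variable {Λ : Finset ℚ} {n : ℕ}

theorem exists_section_eq {x : X} (v : 𝔽.fiber x) :
    ∃ (V : Opens X) (hx : x ∈ V) (s : ∀ y : V, 𝔽.fiber y), 𝔽.sec.pred s ∧ s ⟨x, hx⟩ = v := by
  obtain ⟨V, k, e, hx, he⟩ := 𝔽.locally_free x
  refine ⟨V, hx, fun y => ∑ i, (e ⟨x, hx⟩).repr v i • e y i, ?_, (e ⟨x, hx⟩).sum_repr v⟩
  exact (he V le_rfl _).2 ⟨_, fun i => IsHolSeries.const V _, fun y => rfl⟩

theorem IsFrame.exists_isFrame_iterate_opA {e : ∀ y : U, Module.Basis (Fin k) ℂ⟦X⟧ (𝔽.fiber y)}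
    (he : 𝔽.IsFrame e) {x : U} {f : 𝔽.fiber x}
    (hf : Submodule.span ℂ⟦X⟧ (Set.range fun ν : ℕ => opA^[ν] f) = ⊤) :
    ∃ (V : Opens X) (s : ∀ y : V, 𝔽.fiber y)
      (e' : ∀ y : V, Module.Basis (Fin k) ℂ⟦X⟧ (𝔽.fiber y)),
      V ≤ U ∧ x.1 ∈ V ∧ 𝔽.sec.pred s ∧ 𝔽.IsFrame e' ∧ ∀ y j, e' y j = opA^[j] (s y) := by
  let s (y : U) : 𝔽.fiber y := ∑ i, (e x).repr f i • e y i
  have hs : 𝔽.sec.pred s := he.sum_smul_mem (fun i => IsHolSeries.const U _) he.mem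
  have hsx : s x = f := (e x).sum_repr f
  have hdet : IsHolSeries fun y => (e y).det fun j : Fin k => opA^[j] (s y) :=
    he.isHolSeries_det fun j => iterate_opA_mem hs j
  obtain ⟨V, hV, hxV, hdetV⟩ := exists_opens_of_eventually
    (hdet.eventually_isUnit (x := x) (isUnit_det_iterate_opA (e x) (hsx ▸ hf)))
  have hbasis (y : V) := (e ⟨y, hV y.2⟩).is_basis_iff_det.2 (hdetV y)
  have hsV : 𝔽.sec.pred fun y : V => s ⟨y, hV y.2⟩ := 𝔽.sec.res hV.hom _ hs
  refine ⟨V, _, fun y => .mk (hbasis y).1 (hbasis y).2.ge, hV, hxV, hsV,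
    (he.res hV).of_mem fun j => ?_, fun y j => Module.Basis.mk_apply _ _ j⟩
  simp only [Module.Basis.mk_apply]
  exact iterate_opA_mem hsV j

namespace IsHolEmbedding

theorem res {ι : ∀ y : U, 𝔽.fiber y →ₗ[ℂ⟦X⟧] Xi Λ n} (hι : 𝔽.IsHolEmbedding ι) {V : Opens X}
    (hV : V ≤ U) : 𝔽.IsHolEmbedding fun y : V => ι ⟨y, hV y.2⟩ where
  injective _ := hι.injective _
  commutesWithA _ := hι.commutesWithA _
  isHolXi hW _ hs := hι.isHolXi (hW.trans hV) hs

theorem xiComponent_comp {ι : ∀ y : U, 𝔽.fiber y →ₗ[ℂ⟦X⟧] Xi Λ n} (hι : 𝔽.IsHolEmbedding ι)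
    (hΛ : ∀ l ∈ Λ, 0 < l ∧ l ≤ 1) {l : ℚ} (hl : 0 < l ∧ l ≤ 1)
    (hprim : ∀ y : U, IsPrimitiveTheme l (𝔽.fiber y)) :
    𝔽.IsHolEmbedding fun y => xiComponent Λ n l ∘ₗ ι y where
  injective y :=
    (hprim y).injective_xiComponent_comp hl hΛ (hι.injective y) (hι.commutesWithA y)
  commutesWithA y := (commutesWithA_xiComponent Λ n l).comp (hι.commutesWithA y)
  isHolXi hV s hs ν j := by
    by_cases h : l ∈ Λ
    · simpa only [LinearMap.comp_apply, xiComponent_apply h] using hι.isHolXi hV hs ⟨l, h⟩ j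
    · simpa [xiComponent, h] using IsHolSeries.const _ 0

theorem isThematicAt {ι : ∀ y : U, 𝔽.fiber y →ₗ[ℂ⟦X⟧] Xi Λ k} (hι : 𝔽.IsHolEmbedding ι)
    (hΛ : ∀ l ∈ Λ, 0 < l ∧ l ≤ 1) {s : ∀ y : U, 𝔽.fiber y} (hs : 𝔽.sec.pred s)
    {e : ∀ y : U, Module.Basis (Fin k) ℂ⟦X⟧ (𝔽.fiber y)} (he : 𝔽.IsFrame e)
    (hes : ∀ y j, e y j = opA^[j] (s y)) {x : X} (hx : x ∈ U) : 𝔽.IsThematicAt k x := by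
  have ι_iterate (y : U) (ν : ℕ) : ι y (opA^[ν] (s y)) = opA^[ν] (ι y (s y)) :=
    Function.Semiconj.iterate_right (hι.commutesWithA y) ν (s y)
  have ι_sum (y : U) (c : Fin k → ℂ⟦X⟧) :
      ι y (∑ j, c j • e y j) = ∑ j, c j • opA^[(j : ℕ)] (ι y (s y)) := by
    simp only [map_sum, map_smul, hes, ι_iterate]
  refine ⟨U, Λ, fun y => ι y (s y), ι, hx, hΛ, ⟨hι.isHolXi le_rfl hs, fun y => ?_, fun ν => ?_⟩,
    hι.injective, hι.commutesWithA, fun V hV t => ⟨?_, ?_⟩⟩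
  · simp only [← ι_iterate, ← hes]
    exact (e y).linearIndependent.map' _ (LinearMap.ker_eq_bot.2 (hι.injective y))
  · obtain ⟨c, hc, hcs⟩ := (he U le_rfl _).1 (iterate_opA_mem hs ν)
    exact ⟨c, hc, fun y => by rw [← ι_iterate, hcs, ι_sum]⟩
  · rintro ⟨c, hc, ht⟩
    exact ⟨_, (he V hV _).2 ⟨c, hc, fun y => rfl⟩, fun y => by rw [ι_sum, ht]⟩
  · rintro ⟨r, hr, hrt⟩
    obtain ⟨c, hc, hcr⟩ := (he V hV r).1 hr
    exact ⟨c, hc, fun y => by rw [← hrt, hcr, ι_sum]⟩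

end IsHolEmbedding

theorem IsThematicAt.exists_isHolEmbedding {x : X} (h : 𝔽.IsThematicAt k x) :
    ∃ (U : Opens X) (Λ : Finset ℚ) (ι : ∀ y : U, 𝔽.fiber y →ₗ[ℂ⟦X⟧] Xi Λ k)
      (e : ∀ y : U, Module.Basis (Fin k) ℂ⟦X⟧ (𝔽.fiber y)),
      x ∈ U ∧ (∀ l ∈ Λ, 0 < l ∧ l ≤ 1) ∧ 𝔽.IsHolEmbedding ι ∧ 𝔽.IsFrame e := by
  obtain ⟨U, Λ, φ, ι, hx, hΛ, ⟨hφ, hφ_indep, -⟩, hι, hιa, hsec⟩ := h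
  have holEmbedding : 𝔽.IsHolEmbedding ι := ⟨hι, hιa, fun {V} hV s hs => by
    obtain ⟨c, hc, hcs⟩ := (hsec V hV _).2 ⟨s, hs, fun y => rfl⟩
    rw [funext hcs]
    exact IsHolXi.sum_smul _ (fun j _ => hc j) fun j _ => (hφ.res hV).iterate_opA j⟩
  have range_ι : LinearMap.range (ι ⟨x, hx⟩) =
      Submodule.span ℂ⟦X⟧ (Set.range fun j : Fin k => opA^[(j : ℕ)] (φ ⟨x, hx⟩)) := by
    refine le_antisymm ?_ (Submodule.span_le.2 ?_)
    · rintro _ ⟨v, rfl⟩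
      obtain ⟨V, hxV, s, hs, rfl⟩ := exists_section_eq v
      obtain ⟨c, -, hcs⟩ := (hsec (U ⊓ V) inf_le_left _).2
        ⟨_, 𝔽.sec.res (inf_le_right (a := U) (b := V)).hom _ hs, fun y => rfl⟩
      have hιs : ι ⟨x, hx⟩ (s ⟨x, hxV⟩) =
          ∑ j, c j ⟨x, hx, hxV⟩ • opA^[(j : ℕ)] (φ ⟨x, hx⟩) := hcs ⟨x, hx, hxV⟩
      exact hιs ▸ Submodule.sum_mem _ fun j _ =>
        Submodule.smul_mem _ _ (Submodule.subset_span ⟨j, rfl⟩)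
    · rintro _ ⟨j, rfl⟩
      obtain ⟨s, -, hs⟩ := (hsec U le_rfl fun y => opA^[(j : ℕ)] (φ y)).1
        ⟨fun i _ => if i = j then 1 else 0, fun i => IsHolSeries.const U _, fun y => by simp⟩
      exact ⟨s ⟨x, hx⟩, hs ⟨x, hx⟩⟩
  obtain ⟨V, e, hxV, he⟩ := exists_isFrame ((Module.Basis.span (hφ_indep ⟨x, hx⟩)).map
    ((LinearEquiv.ofEq _ _ range_ι.symm).trans
      (LinearEquiv.ofInjective (ι ⟨x, hx⟩) (hι ⟨x, hx⟩)).symm))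
  exact ⟨U ⊓ V, Λ, _, _, ⟨hx, hxV⟩, hΛ, holEmbedding.res inf_le_left, he.res inf_le_right⟩

end ABSheaf

end Embedding

section HolomorphicChain

variable {X : TopCat.{u}} [ReducedComplexSpace X] {U : Opens X}

namespace ABSheaf

variable {𝔽 : ABSheaf.{u, v} X} {k : ℕ} {ρ : ℂ}
variable {e : ∀ y : U, Module.Basis (Fin k) ℂ⟦X⟧ (𝔽.fiber y)}

theorem IsFrame.isLocallyConstant_order_det (he : 𝔽.IsFrame e) {w : Fin k → ∀ y : U, 𝔽.fiber y}
    (hw_chain : ∀ y, IsJordanChain ρ (w · y))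
    (hw_indep : ∀ y, LinearIndependent ℂ⟦X⟧ (w · y)) :
    IsLocallyConstant fun y => ((e y).toMatrix (w · y)).det.order := by
  refine isLocallyConstant_order ?_ (fun y => det_toMatrix_ne_zero (e y) (hw_indep y))
    fun y => bbD_det_toMatrix (e y) (hw_chain y)
  exact (IsHolSeries.const U _).sub (IsHolSeries.sum _ fun i _ =>
    he.isHolSeries_repr (𝔽.a_mem (he.mem i)) i)

theorem IsFrame.isHolEmbedding_of_map_eq_xiMonomial (he : 𝔽.IsFrame e)
    {w : Fin k → ∀ y : U, 𝔽.fiber y} (hw : ∀ j, 𝔽.sec.pred (w j)) {m : ℕ}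
    (hm : ∀ y, ((e y).toMatrix (w · y)).det.order = m) {l : ℚ} {q : ℕ}
    {κ : ∀ y : U, 𝔽.fiber y →ₗ[ℂ⟦X⟧] Xi {l} k} (hκ : ∀ y, Function.Injective (κ y))
    (hκa : ∀ y, CommutesWithA (κ y)) (hκw : ∀ y j, κ y (w j y) = xiMonomial l q j) :
    𝔽.IsHolEmbedding κ := by
  refine ⟨hκ, hκa, fun {V} hV s hs ν i => ?_⟩
  have hwV (j : Fin k) : 𝔽.sec.pred fun y : V => w j ⟨y, hV y.2⟩ := 𝔽.sec.res hV.hom _ (hw j)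
  have he_res := he.res hV
  refine IsHolSeries.of_mul (he_res.isHolSeries_det hwV)
    ((he_res.isHolSeries_adjugate_mulVec hwV hs i).mul (IsHolSeries.const V (PowerSeries.X ^ q)))
    (fun y => hm ⟨y, hV y.2⟩) fun y => ?_
  have hcramer := congrArg (κ ⟨y, hV y.2⟩)
    (det_toMatrix_smul (e ⟨y, hV y.2⟩) (w · ⟨y, hV y.2⟩) (s y))
  simp only [map_smul, map_sum, hκw] at hcramer
  simpa [xiMonomial, Finset.sum_apply, Pi.single_apply] using congrFun (congrFun hcramer ν) i

theorem IsFrame.exists_isHolEmbedding_of_isJordanChain (he : 𝔽.IsFrame e)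
    (hth : ∀ y : U, IsTheme (𝔽.fiber y)) {w : Fin k → ∀ y : U, 𝔽.fiber y}
    (hw : ∀ j, 𝔽.sec.pred (w j)) {q : ℕ} {l : ℚ} (hl : 0 < l ∧ l ≤ 1)
    (hw_chain : ∀ y, IsJordanChain ((q : ℂ) + (l : ℂ)) (w · y))
    (hw_indep : ∀ y, LinearIndependent ℂ⟦X⟧ (w · y)) (x : U) :
    ∃ (V : Opens X) (κ : ∀ y : V, 𝔽.fiber y →ₗ[ℂ⟦X⟧] Xi {l} k),
      V ≤ U ∧ x.1 ∈ V ∧ 𝔽.IsHolEmbedding κ := by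
  have embedding (y : U) : ∃ κ : 𝔽.fiber y →ₗ[ℂ⟦X⟧] Xi {l} k,
      Function.Injective κ ∧ CommutesWithA κ ∧ ∀ j, κ (w j y) = xiMonomial l q j := by
    obtain ⟨Λ, n, φ, hΛ, θ, hθ, hθa, -⟩ := hth y
    exact exists_embedding_of_isJordanChain (e y) hθ hθa hΛ hl (hw_chain y) (hw_indep y)
  choose κ hκ hκa hκw using embedding
  obtain ⟨V, hV, hxV, horder⟩ := exists_opens_of_eventually
    ((he.isLocallyConstant_order_det hw_chain hw_indep).eventually_eq x)
  rw [← PowerSeries.coe_toNat_order (det_toMatrix_ne_zero (e x) (hw_indep x))] at horder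
  exact ⟨V, fun y => κ ⟨y, hV y.2⟩, hV, hxV, (he.res hV).isHolEmbedding_of_map_eq_xiMonomial
    (fun j => 𝔽.sec.res hV.hom _ (hw j)) horder (fun y => hκ _) (fun y => hκa _)
    fun y => hκw ⟨y, hV y.2⟩⟩

theorem IsHolEmbedding.isThematicAt_of_isTheme {Λ : Finset ℚ}
    {ι : ∀ y : U, 𝔽.fiber y →ₗ[ℂ⟦X⟧] Xi Λ k} (hι : 𝔽.IsHolEmbedding ι)
    (hΛ : ∀ l ∈ Λ, 0 < l ∧ l ≤ 1) (he : 𝔽.IsFrame e) {x : U} (hx : IsTheme (𝔽.fiber x)) :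
    𝔽.IsThematicAt k x := by
  obtain ⟨Λ', n, φ, -, hφ⟩ := hx
  obtain ⟨f, hf⟩ := hφ.exists_span_eq_top
  obtain ⟨V, s, e', hV, hxV, hs, he', hes⟩ := he.exists_isFrame_iterate_opA hf
  exact (hι.res hV).isThematicAt hΛ hs he' hes hxV

theorem isThematicAt_of_isJordanChain {x : U} (b : Module.Basis (Fin k) ℂ⟦X⟧ (𝔽.fiber x))
    (hth : ∀ y : U, IsTheme (𝔽.fiber y)) {w : Fin k → ∀ y : U, 𝔽.fiber y}
    (hw : ∀ j, 𝔽.sec.pred (w j)) (hw_chain : ∀ y, IsJordanChain ρ (w · y))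
    (hw_indep : ∀ y, LinearIndependent ℂ⟦X⟧ (w · y)) : 𝔽.IsThematicAt k x := by
  obtain ⟨W, e, hxW, he⟩ := exists_isFrame b
  obtain ⟨q, l, hl, hchain⟩ : ∃ (q : ℕ) (l : ℚ), (0 < l ∧ l ≤ 1) ∧
      ∀ y, IsJordanChain ((q : ℂ) + (l : ℂ)) (w · y) := by
    rcases k with _ | k
    · exact ⟨0, 1, by norm_num, fun y j => j.elim0⟩
    · obtain ⟨q, l, hl, rfl⟩ :=
        (hw_chain x).exists_exponent_eq (hth x) ((hw_indep x).ne_zero 0)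
      exact ⟨q, l, hl, hw_chain⟩
  have hU : U ⊓ W ≤ U := inf_le_left
  obtain ⟨V, κ, hV, hxV, hκ⟩ :=
    (he.res (inf_le_right : U ⊓ W ≤ W)).exists_isHolEmbedding_of_isJordanChain
      (fun y => hth ⟨y, y.2.1⟩) (fun j => 𝔽.sec.res hU.hom _ (hw j)) hl
      (fun y => hchain ⟨y, y.2.1⟩) (fun y => hw_indep ⟨y, y.2.1⟩) ⟨x, x.2, hxW⟩
  refine hκ.isThematicAt_of_isTheme (x := ⟨x, hxV⟩) (fun μ hμ => ?_)
    (he.res (hV.trans inf_le_right)) (hth x)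
  rwa [Finset.mem_singleton.1 hμ]

theorem IsHolEmbedding.mem_sec_dual_twist {𝔼 : ABSheaf.{u, v} X} {l : ℚ}
    {ι : ∀ y : U, 𝔼.fiber y →ₗ[ℂ⟦X⟧] Xi {l} k} (hι : 𝔼.IsHolEmbedding ι) (δ : ℚ) (j : Fin k) :
    (𝔼.dual.twist δ).sec.pred fun y : U =>
      (untwist δ (ABDual (𝔼.fiber y))).symm (xiCoord l j ∘ₗ ι y) := by
  have hcoord : 𝔼.dual.sec.pred fun y : U => xiCoord l j ∘ₗ ι y := by
    intro V hV s hs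
    change IsHolSeries fun y : V => (xiCoord l j (ι ⟨y, hV y.2⟩ (s y))).series
    simp only [xiCoord_apply]
    exact (IsHolSeries.const V _).mul (hι.isHolXi hV hs _ _)
  have huntwist (y : U) : untwist δ (ABDual (𝔼.fiber y))
      ((untwist δ (ABDual (𝔼.fiber y))).symm (xiCoord l j ∘ₗ ι y)) = xiCoord l j ∘ₗ ι y :=
    LinearEquiv.apply_symm_apply _ _
  exact (congrArg 𝔼.dual.sec.pred (funext huntwist)).mpr hcoord

theorem IsHolEmbedding.isThematicAt_dual_twist {𝔼 : ABSheaf.{u, v} X} {l : ℚ}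
    {ι : ∀ y : U, 𝔼.fiber y →ₗ[ℂ⟦X⟧] Xi {l} k} (hι : 𝔼.IsHolEmbedding ι)
    (e : ∀ y : U, Module.Basis (Fin k) ℂ⟦X⟧ (𝔼.fiber y)) {δ : ℚ}
    (hth : ∀ y : U, IsTheme ((𝔼.dual.twist δ).fiber y)) (x : U) :
    (𝔼.dual.twist δ).IsThematicAt k x := by
  refine isThematicAt_of_isJordanChain (ρ := -(l : ℂ) + (δ : ℂ))
    ((dualB (e x)).map (untwist δ _).symm) hth (fun j => hι.mem_sec_dual_twist δ j)
    (fun y => ?_) fun y => ?_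
  · exact ((isJordanChain_xiCoord l k).map
      (commutesWithA_lcomp (hι.commutesWithA y))).untwist_symm δ
  · exact (linearIndependent_xiCoord_comp (e y) (hι.injective y)).map' _
      (untwist δ (ABDual (𝔼.fiber y))).symm.ker

end ABSheaf

end HolomorphicChain

end Themes

end

theorem theorem1p5p1 {X : TopCat.{u}} [ReducedComplexSpace X] (k : ℕ)
    (l : ℚ) (hl : 0 < l ∧ l ≤ 1)
    (𝔼 : ABSheaf.{u, v} X) (h𝔼 : 𝔼.IsHolomorphicFamily k)
    (hprim : ∀ x : X, IsPrimitiveTheme l (𝔼.fiber x))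
    (δ : ℚ) (hδ : ∀ x : X, IsTheme (ABDual (𝔼.fiber x) ⊗[PowerSeries ℂ] RankOne δ)) :
    (𝔼.dual.twist δ).IsHolomorphicFamily k := by
  intro x
  obtain ⟨U, Λ, ι, e, hx, hΛ, hι, -⟩ := ABSheaf.IsThematicAt.exists_isHolEmbedding (h𝔼 x)
  have hι_prim := hι.xiComponent_comp hΛ hl fun y => hprim y
  exact hι_prim.isThematicAt_dual_twist e (fun y => hδ y) ⟨x, hx⟩
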